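/- Let $\mathcal V$ be a countably infinite set of names, $\mathfrak S(\mathcal V)$ the group of permutations of $\mathcal V$ generated by transpositions, and $\mathsf{Nom}$ the category of nominal sets (sets with an $\mathfrak S(\mathcal V)$-action all of whose elements are finitely supported) and equivariant maps, with forgetful functor $U:\mathsf{Nom}\to\mathsf{Set}$. Let $(\Sigma,\mathsf{ar})$ be a binding signature, i.e. a set $\Sigma$ with a map $\mathsf{ar}:\Sigma\to\mathbb N^*$. *Syntax.* The finite raw terms $T_\Sigma$ (resp. the infinitary raw terms $T_\Sigma^\infty$) are defined inductively (resp. coinductively): names are terms, and $\mathsf{op}(\langle\bar x_1\rangle.t_1,\dots,\langle\bar x_k\rangle.t_k)$ is a term if $\mathsf{ar}(\mathsf{op})=n_1,\dots,n_k$, $\bar x_i$ is a list of $n_i$ names and the $t_i$ are terms. The truncation $t^n$ replaces all subterms at depth $n$ by a constant $*$. On finite terms, $\mathsf{fv}(x)=\{x\}$ and $\mathsf{fv}(\mathsf{op}(\langle\bar x_i\rangle.t_i)_i)=\bigcup_i(\mathsf{fv}(t_i)\setminus\bar x_i)$, and $=_\alpha$ is generated by $x=_\alpha x$ and by: $\mathsf{op}(\langle\bar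 x_i\rangle.t_i)_i=_\alpha\mathsf{op}(\langle\bar y_i\rangle.s_i)_i$ if for each $i$ there is a list $\bar z_i$ of $n_i$ distinct names, not occurring in either term, with $(\bar x_i\,\bar z_i)\cdot t_i=_\alpha(\bar y_i\,\bar z_i)\cdot s_i$. For infinitary terms, $\mathsf{fv}(t)=\bigcup_n\mathsf{fv}(t^n)$, and $t=_\alpha s$ iff $t^n=_\alpha s^n$ for all $n$. Let $d(t,s)=\inf\{2^{-n}\mid t^n=s^n\}$ on $T_\Sigma^\infty$, let $(T_\Sigma^\infty)_{\rm ffv}=\{t\in T_\Sigma^\infty\mid \mathsf{fv}(t)\text{ finite}\}$, let $(T_\Sigma/{=_\alpha})^\infty$ be the metric completion of $T_\Sigma/{=_\alpha}$ for $d_\alpha([t]_\alpha,[s]_\alpha)=\inf\{2^{-n}\mid t^n=_\alpha s^n\}$, with the induced $\mathfrak S(\mathcal V)$-action, and let $((T_\Sigma/{=_\alpha})^\infty)_{\sf fs}$ be its set of finitely supported elements. Let $[-]_\alpha:T_\Sigma^\infty\to(T_\Sigma/{=_\alpha})^\infty$ be the continuous extension of $T_\Sigma\to T_\Sigma/{=_\alpha}$;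 it restricts to $[-]_\alpha:(T_\Sigma^\infty)_{\rm ffv}\to((T_\Sigma/{=_\alpha})^\infty)_{\sf fs}$. *Semantics.* Let $\mathsf F,\mathsf F_\alpha:\mathsf{Nom}\to\mathsf{Nom}$, $$\mathsf F X=\mathcal V+\coprod_{\mathsf{op}}\prod_{i}(\mathcal V^{n_i}\times X),\qquad \mathsf F_\alpha X=\mathcal V+\coprod_{\mathsf{op}}\prod_{i}[\mathcal V]^{n_i}X,$$ where $\mathsf{ar}(\mathsf{op})=n_1,\dots,n_k$, $1\le i\le k$, and $[\mathcal V]X$ is the abstraction $(\mathcal V\times X)/{\sim_\alpha}$ with classes $\langle x\rangle u$; let $q:\mathsf F\to\mathsf F_\alpha$ be the natural transformation induced by $(x_1,\dots,x_n,u)\mapsto\langle x_1\rangle\cdots\langle x_n\rangle u$. Let $\mathsf I,\mathsf I_\alpha$ be initial algebras and $\mathsf T,\mathsf T_\alpha$ final coalgebras of $\mathsf F,\mathsf F_\alpha$. Then $q$ induces maps $[-]_\alpha:\mathsf I\to\mathsf I_\alpha$, $\mathsf T\to\mathsf T_\alpha$, $\mathsf F^n1\to\mathsf F_\alpha^n1$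 and $\lim U\mathsf F^n1\to\lim U\mathsf F^n_\alpha1$ (limits in $\mathsf{Set}$); the projections of the final coalgebras induce $\iota:U\mathsf T\to\lim U\mathsf F^n1$ and $\iota_\alpha:U\mathsf T_\alpha\to\lim U\mathsf F_\alpha^n1$; $P$ is the pullback in $\mathsf{Set}$ of $[-]_\alpha:\lim U\mathsf F^n1\to\lim U\mathsf F_\alpha^n1$ and $\iota_\alpha$, with projection $[-]_\alpha:P\to U\mathsf T_\alpha$; and $U\mathsf I\to P$ is the composite of the canonical map $U\mathsf I\to U\mathsf T$ and the map $U\mathsf T\to P$ given by $\iota$ and $[-]_\alpha$. **Theorem.** Completing $T_\Sigma$ by Cauchy sequences $(t_n)_n$ such that $\bigcup_n\mathsf{fv}(t_n)$ is finite, and quotienting by $\alpha$-equivalence, commute. That is: 1. The elements of $(T_\Sigma^\infty)_{\rm ffv}$ are exactly the limits in $T_\Sigma^\infty$ of sequences $(t_n)_n$ in $T_\Sigma$ with $\bigcup_n\mathsf{fv}(t_n)$ finite, and every Cauchy sequence of this kind has a unique limit in $(T_\Sigma^\infty)_{\rm ffv}$. 2. (Syntactic version.) The square formed by $T_\Sigma\hookrightarrow(T_\Sigma^\infty)_{\rm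 ffv}\xrightarrow{[-]_\alpha}((T_\Sigma/{=_\alpha})^\infty)_{\sf fs}$ and $T_\Sigma\twoheadrightarrow T_\Sigma/{=_\alpha}\to((T_\Sigma/{=_\alpha})^\infty)_{\sf fs}$ commutes; two elements of $(T_\Sigma^\infty)_{\rm ffv}$ have the same image under $[-]_\alpha$ iff they are $\alpha$-equivalent; and $[-]_\alpha:(T_\Sigma^\infty)_{\rm ffv}\to((T_\Sigma/{=_\alpha})^\infty)_{\sf fs}$ is surjective, i.e. each element of $((T_\Sigma/{=_\alpha})^\infty)_{\sf fs}$ is the equivalence class of an infinitary raw term with finitely many free variables. 3. (Semantic version.) $\mathsf I,\mathsf I_\alpha,\mathsf T,\mathsf T_\alpha$ exist; the square formed by $U\mathsf I\to P\xrightarrow{[-]_\alpha}U\mathsf T_\alpha$ and $U\mathsf I\xrightarrow{[-]_\alpha}U\mathsf I_\alpha\to U\mathsf T_\alpha$ commutes; and $[-]_\alpha:\mathsf I\to\mathsf I_\alpha$ and $[-]_\alpha:P\to U\mathsf T_\alpha$ are surjective. 4. The two squares are equivalent: there are bijections $U\mathsf I\cong T_\Sigma$, $U\mathsf I_\alpha\cong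 T_\Sigma/{=_\alpha}$, $P\cong(T_\Sigma^\infty)_{\rm ffv}$ and $U\mathsf T_\alpha\cong((T_\Sigma/{=_\alpha})^\infty)_{\sf fs}$, the first, second and fourth of them equivariant, that commute with the four maps of the squares. -/

import Mathlib

open CategoryTheory CategoryTheory.Limits Filter Topology

universe u

noncomputable section

/-! ### Names, finite permutations, nominal sets -/

open Classical in
/-- The group of permutations of the names generated by transpositions. -/
def finPerm (V : Type u) : Subgroup (Equiv.Perm V) :=
  Subgroup.closure {σ | ∃ x y : V, x ≠ y ∧ σ = Equiv.swap x y}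

abbrev FinPerm (V : Type u) : Type u := ↥(finPerm V)

open Classical in
/-- The transposition `(x z)` (the identity if `x = z`). -/
def transp {V : Type u} (x z : V) : FinPerm V :=
  ⟨Equiv.swap x z, by
    by_cases h : x = z
    · subst h
      rw [Equiv.swap_self]
      exact (finPerm V).one_mem
    · exact Subgroup.subset_closure ⟨x, z, h, rfl⟩⟩

open Classical in
theorem transp_smul {V : Type u} (x z v : V) : transp x z • v = Equiv.swap x z v := rfl

/-- `u` is finitely supported for an action of the finite permutations of the names. -/
def FinSupp (V : Type u) {X : Type u} [MulAction (FinPerm V) X] (u : X) : Prop :=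
  ∃ A : Set V, A.Finite ∧ MulAction.Supports (FinPerm V) A u

/-- The support: the intersection of all finite supporting sets (on a finitely supported element,
the least finite supporting set). -/
def nsupp (V : Type u) {X : Type u} [MulAction (FinPerm V) X] (u : X) : Set V :=
  ⋂₀ {A : Set V | A.Finite ∧ MulAction.Supports (FinPerm V) A u}

/-- Nominal sets over the names `V`. -/
structure Nom (V : Type u) where
  carrier : Type u
  [act : MulAction (FinPerm V) carrier]
  finSupp : ∀ a : carrier, FinSupp V a

attribute [instance] Nom.act

instance (V : Type u) : CoeSort (Nom V) (Type u) := ⟨Nom.carrier⟩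

/-- Morphisms of nominal sets are the equivariant maps. -/
instance (V : Type u) : Category (Nom V) where
  Hom X Y := X.carrier →[FinPerm V] Y.carrier
  id X := MulActionHom.id (FinPerm V)
  comp f g := MulActionHom.comp g f

namespace Nom

variable {V : Type u}

/-- The underlying function of a morphism of nominal sets (the forgetful functor to sets). -/
def fn {X Y : Nom V} (f : X ⟶ Y) : X → Y := MulActionHom.toFun f

theorem fn_smul {X Y : Nom V} (f : X ⟶ Y) (π : FinPerm V) (a : X) :
    fn f (π • a) = π • fn f a := MulActionHom.map_smul' f π a

theorem hom_ext {X Y : Nom V} {f g : X ⟶ Y} (h : ∀ a, fn f a = fn g a) : f = g :=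
  MulActionHom.ext h

@[simp] theorem fn_id (X : Nom V) (a : X) : fn (𝟙 X) a = a := rfl

@[simp] theorem fn_comp {X Y Z : Nom V} (f : X ⟶ Y) (g : Y ⟶ Z) (a : X) :
    fn (f ≫ g) a = fn g (fn f a) := rfl

/-- Build a morphism of nominal sets. -/
def mkHom {X Y : Nom V} (f : X → Y) (h : ∀ (π : FinPerm V) (a : X), f (π • a) = π • f a) :
    X ⟶ Y := ({ toFun := f, map_smul' := h } : X.carrier →[FinPerm V] Y.carrier)

@[simp] theorem fn_mkHom {X Y : Nom V} (f : X → Y)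
    (h : ∀ (π : FinPerm V) (a : X), f (π • a) = π • f a) (a : X) : fn (mkHom f h) a = f a := rfl

theorem supports_fn {X Y : Nom V} (f : X ⟶ Y) {A : Set V} {a : X}
    (h : MulAction.Supports (FinPerm V) A a) : MulAction.Supports (FinPerm V) A (fn f a) := by
  intro π hπ
  rw [← fn_smul, h π hπ]

/-- The terminal nominal set. -/
def one (V : Type u) : Nom V where
  carrier := PUnit
  act := { smul := fun _ a => a, one_smul := fun _ => rfl, mul_smul := fun _ _ _ => rfl }
  finSupp _ := ⟨∅, Set.finite_empty, fun _ _ => rfl⟩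

/-- The unique map to the terminal nominal set. -/
def toOne (X : Nom V) : X ⟶ one V := mkHom (fun _ => PUnit.unit) (fun _ _ => rfl)

end Nom

theorem finSupp_name {V : Type u} (x : V) : FinSupp V x :=
  ⟨{x}, Set.finite_singleton x, fun _ h => h rfl⟩

theorem finSupp_prod {V X Y : Type u} [MulAction (FinPerm V) X] [MulAction (FinPerm V) Y]
    {p : X × Y} (h₁ : FinSupp V p.1) (h₂ : FinSupp V p.2) : FinSupp V p := by
  obtain ⟨A, hA, sA⟩ := h₁
  obtain ⟨B, hB, sB⟩ := h₂
  refine ⟨A ∪ B, hA.union hB, fun π hπ => ?_⟩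
  exact Prod.ext (sA π fun a ha => hπ (Or.inl ha)) (sB π fun a ha => hπ (Or.inr ha))

theorem finSupp_pi {V : Type u} {ι : Type} [Finite ι] {X : ι → Type u}
    [∀ i, MulAction (FinPerm V) (X i)] {p : ∀ i, X i} (h : ∀ i, FinSupp V (p i)) :
    FinSupp V p := by
  choose A hA sA using h
  refine ⟨⋃ i, A i, Set.finite_iUnion hA, fun π hπ => ?_⟩
  funext i
  exact sA i π fun a ha => hπ (Set.mem_iUnion.2 ⟨i, ha⟩)

/-! ### The abstraction functor `[V](-)` -/

/-- `(x₁,u₁) ∼ (x₂,u₂)` iff `(x₁ z)·u₁ = (x₂ z)·u₂` for some `z` fresh for `x₁,u₁,x₂,u₂`. -/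
def AbsRel {V : Type u} (X : Nom V) (p q : V × X) : Prop :=
  ∃ z : V, z ≠ p.1 ∧ z ≠ q.1 ∧ z ∉ nsupp V p.2 ∧ z ∉ nsupp V q.2 ∧
    transp p.1 z • p.2 = transp q.1 z • q.2

theorem transp_conj {V : Type u} (π : FinPerm V) (x z : V) :
    transp (π • x) (π • z) * π = π * transp x z := by
  classical
  apply Subtype.ext
  change Equiv.swap (π.1 x) (π.1 z) * π.1 = π.1 * Equiv.swap x z
  rw [Equiv.mul_swap_eq_swap_mul]

theorem notMem_nsupp_iff {V X : Type u} [MulAction (FinPerm V) X] (u : X) (z : V) :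
    z ∉ nsupp V u ↔ ∃ A : Set V, A.Finite ∧ MulAction.Supports (FinPerm V) A u ∧ z ∉ A := by
  simp [nsupp]

theorem notMem_nsupp_smul {V X : Type u} [MulAction (FinPerm V) X] (π : FinPerm V) {u : X} {z : V}
    (h : z ∉ nsupp V u) : π • z ∉ nsupp V (π • u) := by
  rw [notMem_nsupp_iff] at h ⊢
  obtain ⟨A, hA, sA, hz⟩ := h
  refine ⟨(fun a => π • a) '' A, hA.image _, fun ρ hρ => ?_, ?_⟩
  · have : (π⁻¹ * ρ * π) • u = u := sA _ fun a ha => by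
      have := hρ (Set.mem_image_of_mem (fun a => π • a) ha)
      change ρ • π • a = π • a at this
      rw [mul_smul, mul_smul, this, inv_smul_smul]
    rw [mul_smul, mul_smul, inv_smul_eq_iff] at this
    exact this
  · rintro ⟨a, ha, e⟩
    exact hz (MulAction.injective π e ▸ ha)

theorem notMem_nsupp_fn {V : Type u} {X Y : Nom V} (f : X ⟶ Y) {a : X} {z : V}
    (h : z ∉ nsupp V a) : z ∉ nsupp V (Nom.fn f a) := by
  rw [notMem_nsupp_iff] at h ⊢
  obtain ⟨A, hA, sA, hz⟩ := h
  exact ⟨A, hA, Nom.supports_fn f sA, hz⟩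

theorem AbsRel.smul {V : Type u} {X : Nom V} {p q : V × X} (h : AbsRel X p q) (π : FinPerm V) :
    AbsRel X (π • p) (π • q) := by
  obtain ⟨z, h1, h2, h3, h4, h5⟩ := h
  refine ⟨π • z, fun e => h1 (MulAction.injective π e), fun e => h2 (MulAction.injective π e),
    notMem_nsupp_smul π h3, notMem_nsupp_smul π h4, ?_⟩
  change transp (π • p.1) (π • z) • π • p.2 = transp (π • q.1) (π • z) • π • q.2
  rw [← mul_smul, ← mul_smul, transp_conj, transp_conj, mul_smul, mul_smul, h5]

/-- The abstraction `[V]X`, the set of classes `⟨x⟩u`, with `π·⟨x⟩u = ⟨π·x⟩(π·u)`. -/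
def Nom.abs {V : Type u} (X : Nom V) : Nom V where
  carrier := Quot (AbsRel X)
  act :=
    { smul := fun π => Quot.map (fun p => π • p) (fun _ _ h => h.smul π)
      one_smul := by
        rintro ⟨p⟩
        exact congrArg (Quot.mk _) (one_smul _ p)
      mul_smul := by
        rintro π ρ ⟨p⟩
        exact congrArg (Quot.mk _) (mul_smul π ρ p) }
  finSupp := by
    rintro ⟨p⟩
    obtain ⟨A, hA, sA⟩ : FinSupp V p := finSupp_prod (finSupp_name p.1) (X.finSupp p.2)
    exact ⟨A, hA, fun π hπ => congrArg (Quot.mk _) (sA π hπ)⟩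

/-- The class `⟨x⟩u`. -/
def absMk {V : Type u} {X : Nom V} (x : V) (a : X) : X.abs := Quot.mk (AbsRel X) (x, a)

theorem smul_absMk {V : Type u} {X : Nom V} (π : FinPerm V) (x : V) (a : X) :
    π • absMk x a = absMk (π • x) (π • a) := rfl

theorem AbsRel.map {V : Type u} {X Y : Nom V} (f : X ⟶ Y) {p q : V × X} (h : AbsRel X p q) :
    AbsRel Y (p.1, Nom.fn f p.2) (q.1, Nom.fn f q.2) := by
  obtain ⟨z, h1, h2, h3, h4, h5⟩ := h
  refine ⟨z, h1, h2, notMem_nsupp_fn f h3, notMem_nsupp_fn f h4, ?_⟩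
  change transp p.1 z • Nom.fn f p.2 = transp q.1 z • Nom.fn f q.2
  rw [← Nom.fn_smul, ← Nom.fn_smul, h5]

/-- `[V]f : ⟨x⟩u ↦ ⟨x⟩f(u)`. -/
def Nom.absMap {V : Type u} {X Y : Nom V} (f : X ⟶ Y) : X.abs ⟶ Y.abs :=
  Nom.mkHom (X := X.abs) (Y := Y.abs)
    (Quot.map (fun p => (p.1, Nom.fn f p.2)) (fun _ _ h => h.map f)) (by
      rintro π ⟨p⟩
      exact congrArg (fun b => Quot.mk (AbsRel Y) (π • p.1, b)) (Nom.fn_smul f π p.2))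

/-- The abstraction functor. -/
def absFunctor (V : Type u) : Nom V ⥤ Nom V where
  obj X := X.abs
  map f := Nom.absMap f
  map_id X := Nom.hom_ext (by rintro ⟨p⟩; rfl)
  map_comp f g := Nom.hom_ext (by rintro ⟨p⟩; rfl)

/-- The iterated abstraction functor `[V]ⁿ(-)`. -/
def absPow (V : Type u) : ℕ → (Nom V ⥤ Nom V)
  | 0 => 𝟭 (Nom V)
  | n + 1 => absPow V n ⋙ absFunctor V

/-- `(x₁,…,xₙ,u) ↦ ⟨x₁⟩…⟨xₙ⟩u`. -/
def absMany {V : Type u} {X : Nom V} : (n : ℕ) → (Fin n → V) → X → (absPow V n).obj X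
  | 0, _, a => a
  | n + 1, x, a => absMk (X := (absPow V n).obj X) (x 0) (absMany n (Fin.tail x) a)

theorem absMany_smul {V : Type u} {X : Nom V} (π : FinPerm V) :
    ∀ (n : ℕ) (x : Fin n → V) (a : X), absMany n (π • x) (π • a) = π • absMany n x a
  | 0, _, _ => rfl
  | n + 1, x, a => by
    have ih := absMany_smul π n (Fin.tail x) a
    exact congrArg (absMk (X := (absPow V n).obj X) (π • x 0)) ih

theorem absMany_map {V : Type u} {X Y : Nom V} (f : X ⟶ Y) :
    ∀ (n : ℕ) (x : Fin n → V) (a : X),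
      Nom.fn ((absPow V n).map f) (absMany n x a) = absMany n x (Nom.fn f a)
  | 0, _, _ => rfl
  | n + 1, x, a => by
    have ih := absMany_map f n (Fin.tail x) a
    exact congrArg (absMk (X := (absPow V n).obj Y) (x 0)) ih

/-! ### Binding signatures and their functors -/

theorem inr_sigma_congr {A ι : Type u} {B : ι → Type u} (f : ι) {p q : B f} (h : p = q) :
    (Sum.inr ⟨f, p⟩ : A ⊕ Σ f, B f) = Sum.inr ⟨f, q⟩ := by rw [h]

/-- A binding signature: operations `op` with binding arities `ar op = n₁,…,n_k`. -/
structure BindingSignature where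
  Op : Type u
  ar : Op → List ℕ

namespace BindingSignature

/-- The number `k` of arguments of an operation. -/
abbrev numArgs (S : BindingSignature.{u}) (f : S.Op) : ℕ := (S.ar f).length

/-- The number `nᵢ` of names bound in the `i`-th argument of an operation. -/
abbrev numBind (S : BindingSignature.{u}) (f : S.Op) (i : Fin (S.numArgs f)) : ℕ := (S.ar f).get i

variable (S : BindingSignature.{u}) (V : Type u)

/-- `F X = V + ∐_op (V^{n₁} × X) × … × (V^{n_k} × X)` on nominal sets. -/
def rawObj (X : Nom V) : Nom V where
  carrier := V ⊕ (Σ f : S.Op, ∀ i : Fin (S.numArgs f), (Fin (S.numBind f i) → V) × X)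
  finSupp := by
    rintro (x | ⟨f, p⟩)
    · obtain ⟨A, hA, sA⟩ := finSupp_name x
      exact ⟨A, hA, fun π hπ => congrArg Sum.inl (sA π hπ)⟩
    · obtain ⟨A, hA, sA⟩ : FinSupp V p := finSupp_pi fun i =>
        finSupp_prod (finSupp_pi fun _ => finSupp_name _) (X.finSupp _)
      exact ⟨A, hA, fun π hπ => inr_sigma_congr f (sA π hπ)⟩

/-- The functor `F` on nominal sets whose initial algebra is the set of finite raw terms. -/
def rawFunctor : Nom V ⥤ Nom V where
  obj X := rawObj S V X
  map {X Y} g := Nom.mkHom (X := rawObj S V X) (Y := rawObj S V Y)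
    (Sum.map id (Sigma.map id fun _ p i => ((p i).1, Nom.fn g (p i).2))) (by
      rintro π (x | ⟨f, p⟩)
      · rfl
      · refine inr_sigma_congr f (funext fun i => ?_)
        exact congrArg (Prod.mk _) (Nom.fn_smul g π (p i).2))
  map_id X := Nom.hom_ext (by rintro (x | ⟨f, p⟩) <;> rfl)
  map_comp g h := Nom.hom_ext (by rintro (x | ⟨f, p⟩) <;> rfl)

/-- `F_α X = V + ∐_op [V]^{n₁}X × … × [V]^{n_k}X` on nominal sets. -/
def alphaObj (X : Nom V) : Nom V where
  carrier := V ⊕ (Σ f : S.Op, ∀ i : Fin (S.numArgs f), (absPow V (S.numBind f i)).obj X)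
  finSupp := by
    rintro (x | ⟨f, p⟩)
    · obtain ⟨A, hA, sA⟩ := finSupp_name x
      exact ⟨A, hA, fun π hπ => congrArg Sum.inl (sA π hπ)⟩
    · obtain ⟨A, hA, sA⟩ : FinSupp V p := finSupp_pi fun i => Nom.finSupp _ (p i)
      exact ⟨A, hA, fun π hπ => inr_sigma_congr f (sA π hπ)⟩

/-- The functor `F_α` on nominal sets. -/
def alphaFunctor : Nom V ⥤ Nom V where
  obj X := alphaObj S V X
  map {X Y} g := Nom.mkHom (X := alphaObj S V X) (Y := alphaObj S V Y)
    (Sum.map id (Sigma.map id fun f p i => Nom.fn ((absPow V (S.numBind f i)).map g) (p i))) (by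
      rintro π (x | ⟨f, p⟩)
      · rfl
      · refine inr_sigma_congr f (funext fun i => ?_)
        exact Nom.fn_smul ((absPow V (S.numBind f i)).map g) π (p i))
  map_id X := Nom.hom_ext (by
    rintro (x | ⟨f, p⟩)
    · rfl
    · refine inr_sigma_congr f (funext fun i => ?_)
      simp)
  map_comp g h := Nom.hom_ext (by
    rintro (x | ⟨f, p⟩)
    · rfl
    · refine inr_sigma_congr f (funext fun i => ?_)
      exact congrArg (fun k => Nom.fn k (p i)) ((absPow V (S.numBind f i)).map_comp g h))

/-- The natural transformation `q : F ⟶ F_α`, replacing each `(x₁,…,xₙ,u)` by `⟨x₁⟩…⟨xₙ⟩u`. -/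
def quot : rawFunctor S V ⟶ alphaFunctor S V where
  app X := Nom.mkHom (X := rawObj S V X) (Y := alphaObj S V X)
    (Sum.map id (Sigma.map id fun f p i => absMany (S.numBind f i) (p i).1 (p i).2)) (by
      rintro π (x | ⟨f, p⟩)
      · rfl
      · refine inr_sigma_congr f (funext fun i => ?_)
        exact absMany_smul π (S.numBind f i) (p i).1 (p i).2)
  naturality X Y g := Nom.hom_ext (by
    rintro (x | ⟨f, p⟩)
    · rfl
    · refine inr_sigma_congr f (funext fun i => ?_)
      exact (absMany_map g (S.numBind f i) (p i).1 (p i).2).symm)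

end BindingSignature

/-! ### Terminal sequences, initial algebras and final coalgebras -/

section Sequences

variable {V : Type u}

/-- The `n`-th object `Gⁿ1` of the terminal sequence. -/
def iter (G : Nom V ⥤ Nom V) : ℕ → Nom V
  | 0 => Nom.one V
  | n + 1 => G.obj (iter G n)

/-- The connecting map `Gⁿ! : Gⁿ⁺¹1 ⟶ Gⁿ1` of the terminal sequence. -/
def iterProj (G : Nom V ⥤ Nom V) : (n : ℕ) → (iter G (n + 1) ⟶ iter G n)
  | 0 => Nom.toOne _
  | n + 1 => G.map (iterProj G n)

/-- The limit of the sets `U Gⁿ1`, computed in the category of sets. -/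
def LimU (G : Nom V ⥤ Nom V) : Type u :=
  {a : ∀ n, iter G n // ∀ n, Nom.fn (iterProj G n) (a (n + 1)) = a n}

/-- The cone over the terminal sequence induced by a coalgebra. -/
def cone {G : Nom V ⥤ Nom V} (C : Endofunctor.Coalgebra G) : (n : ℕ) → (C.V ⟶ iter G n)
  | 0 => Nom.toOne _
  | n + 1 => C.str ≫ G.map (cone C n)

theorem cone_comp {G : Nom V ⥤ Nom V} (C : Endofunctor.Coalgebra G) :
    ∀ n, cone C (n + 1) ≫ iterProj G n = cone C n
  | 0 => rfl
  | n + 1 => by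
    change (C.str ≫ G.map (cone C (n + 1))) ≫ G.map (iterProj G n) = C.str ≫ G.map (cone C n)
    rw [Category.assoc, ← G.map_comp, cone_comp C n]

/-- The map `ι : U C → lim U Gⁿ1` induced by the cone of a coalgebra `C`. -/
def toLim {G : Nom V ⥤ Nom V} (C : Endofunctor.Coalgebra G) (c : C.V) : LimU G :=
  ⟨fun n => Nom.fn (cone C n) c, fun n => by rw [← Nom.fn_comp, cone_comp]⟩

/-- The canonical map from an initial algebra to a final coalgebra: the unique coalgebra morphism
out of the initial algebra, made a coalgebra by the inverse of its structure map. -/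
def initialToFinal {G : Nom V ⥤ Nom V} {I : Endofunctor.Algebra G} (hI : IsInitial I)
    {T : Endofunctor.Coalgebra G} (hT : IsTerminal T) : I.a ⟶ T.V :=
  (hT.from ⟨I.a, Endofunctor.Algebra.Initial.strInv hI⟩).f

variable (S : BindingSignature.{u})

/-- The maps `[-]_α⁽ⁿ⁾ : Fⁿ1 ⟶ F_αⁿ1`. -/
def alphaIter (V : Type u) : (n : ℕ) → (iter (S.rawFunctor V) n ⟶ iter (S.alphaFunctor V) n)
  | 0 => 𝟙 _
  | n + 1 => (S.rawFunctor V).map (alphaIter V n) ≫ (S.quot V).app _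

theorem alphaIter_comp : ∀ n, alphaIter S V (n + 1) ≫ iterProj (S.alphaFunctor V) n =
    iterProj (S.rawFunctor V) n ≫ alphaIter S V n
  | 0 => rfl
  | n + 1 => by
    change ((S.rawFunctor V).map (alphaIter S V (n + 1)) ≫ (S.quot V).app _) ≫
      (S.alphaFunctor V).map (iterProj (S.alphaFunctor V) n) =
      (S.rawFunctor V).map (iterProj (S.rawFunctor V) n) ≫
        (S.rawFunctor V).map (alphaIter S V n) ≫ (S.quot V).app _
    rw [Category.assoc, ← (S.quot V).naturality, ← Category.assoc, ← Category.assoc,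
      ← Functor.map_comp, ← Functor.map_comp, alphaIter_comp n]

/-- The map `[-]_α : lim U Fⁿ1 → lim U F_αⁿ1`. -/
def alphaLim (a : LimU (S.rawFunctor V)) : LimU (S.alphaFunctor V) :=
  ⟨fun n => Nom.fn (alphaIter S V n) (a.1 n), fun n => by
    rw [← Nom.fn_comp, alphaIter_comp, Nom.fn_comp, a.2]⟩

/-- The map `[-]_α : I ⟶ I_α` from the initial `F`-algebra to an `F_α`-algebra induced by `q`. -/
def alphaInitial {I : Endofunctor.Algebra (S.rawFunctor V)} (hI : IsInitial I)
    (Iα : Endofunctor.Algebra (S.alphaFunctor V)) : I.a ⟶ Iα.a :=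
  (hI.to ((Endofunctor.Algebra.functorOfNatTrans (S.quot V)).obj Iα)).f

/-- The map `[-]_α : T ⟶ T_α` from an `F`-coalgebra to the final `F_α`-coalgebra induced by `q`. -/
def alphaFinal (T : Endofunctor.Coalgebra (S.rawFunctor V))
    {Tα : Endofunctor.Coalgebra (S.alphaFunctor V)} (hTα : IsTerminal Tα) : T.V ⟶ Tα.V :=
  (hTα.from ((Endofunctor.Coalgebra.functorOfNatTrans (S.quot V)).obj T)).f

theorem alphaFinal_cone (T : Endofunctor.Coalgebra (S.rawFunctor V))
    {Tα : Endofunctor.Coalgebra (S.alphaFunctor V)} (hTα : IsTerminal Tα) :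
    ∀ n, cone T n ≫ alphaIter S V n = alphaFinal S T hTα ≫ cone Tα n
  | 0 => rfl
  | n + 1 => by
    have h : (T.str ≫ (S.quot V).app T.V) ≫ (S.alphaFunctor V).map (alphaFinal S T hTα) =
        alphaFinal S T hTα ≫ Tα.str :=
      (hTα.from ((Endofunctor.Coalgebra.functorOfNatTrans (S.quot V)).obj T)).h
    change (T.str ≫ (S.rawFunctor V).map (cone T n)) ≫
        (S.rawFunctor V).map (alphaIter S V n) ≫ (S.quot V).app _ =
      alphaFinal S T hTα ≫ Tα.str ≫ (S.alphaFunctor V).map (cone Tα n)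
    rw [← Category.assoc (alphaFinal S T hTα), ← h, Category.assoc, Category.assoc,
      ← Functor.map_comp, ← Category.assoc ((S.rawFunctor V).map _), ← Functor.map_comp,
      alphaFinal_cone T hTα n, Category.assoc, (S.quot V).naturality]

/-- The pullback `P`, in sets, of `[-]_α : lim U Fⁿ1 → lim U F_αⁿ1` and
`ι_α : U T_α → lim U F_αⁿ1`. -/
abbrev PB (Tα : Endofunctor.Coalgebra (S.alphaFunctor V)) : Type u :=
  Function.Pullback (alphaLim S (V := V)) (toLim Tα)

/-- The map `[-]_α : P → U T_α`. -/
def alphaPB (Tα : Endofunctor.Coalgebra (S.alphaFunctor V)) (p : PB S Tα) : Tα.V :=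
  Function.Pullback.snd p

/-- The map `U T → P` induced by `ι : U T → lim U Fⁿ1` and `[-]_α : T ⟶ T_α`. -/
def finalToPB (T : Endofunctor.Coalgebra (S.rawFunctor V))
    {Tα : Endofunctor.Coalgebra (S.alphaFunctor V)} (hTα : IsTerminal Tα) (t : T.V) : PB S Tα :=
  ⟨(toLim T t, Nom.fn (alphaFinal S T hTα) t), Subtype.ext (funext fun n => by
    change Nom.fn (alphaIter S V n) (Nom.fn (cone T n) t) =
      Nom.fn (cone Tα n) (Nom.fn (alphaFinal S T hTα) t)
    rw [← Nom.fn_comp, ← Nom.fn_comp, alphaFinal_cone])⟩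

/-- The map `U I → P`, composed of the canonical map `I ⟶ T` and of `U T → P`. -/
def initialToPB {I : Endofunctor.Algebra (S.rawFunctor V)} (hI : IsInitial I)
    {T : Endofunctor.Coalgebra (S.rawFunctor V)} (hT : IsTerminal T)
    {Tα : Endofunctor.Coalgebra (S.alphaFunctor V)} (hTα : IsTerminal Tα) (a : I.a) : PB S Tα :=
  finalToPB S T hTα (Nom.fn (initialToFinal hI hT) a)

end Sequences

/-! ### Finite raw terms and α-equivalence -/

/-- Finite raw terms: `op f x t` is `op(⟨x₁⟩.t₁,…,⟨x_k⟩.t_k)`, each `xᵢ` a list of `nᵢ` names. -/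
inductive RawTerm (S : BindingSignature.{u}) (V : Type u) : Type u
  | var (x : V) : RawTerm S V
  | op (f : S.Op) (x : ∀ i : Fin (S.numArgs f), Fin (S.numBind f i) → V)
      (t : Fin (S.numArgs f) → RawTerm S V) : RawTerm S V

namespace RawTerm

variable {S : BindingSignature.{u}} {V : Type u}

/-- Renaming of all (free, bound and binding) names. -/
def rename (g : V → V) : RawTerm S V → RawTerm S V
  | var x => var (g x)
  | op f x t => op f (fun i j => g (x i j)) (fun i => rename g (t i))

instance : MulAction (FinPerm V) (RawTerm S V) where
  smul π t := t.rename (fun x => π • x)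
  one_smul t := by
    change t.rename (fun x => (1 : FinPerm V) • x) = t
    induction t with
    | var x => rfl
    | op f x t ih => exact congrArg (op f x) (funext ih)
  mul_smul π ρ t := by
    change t.rename (fun x => (π * ρ) • x) =
      (t.rename (fun x => ρ • x)).rename (fun x => π • x)
    induction t with
    | var x => rfl
    | op f x t ih => exact congrArg (op f _) (funext ih)

theorem smul_var (π : FinPerm V) (x : V) : π • (var x : RawTerm S V) = var (π • x) := rfl

theorem smul_op (π : FinPerm V) (f : S.Op) (x : ∀ i : Fin (S.numArgs f), Fin (S.numBind f i) → V)
    (t : Fin (S.numArgs f) → RawTerm S V) :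
    π • op f x t = op f (fun i j => π • x i j) (fun i => π • t i) := rfl

/-- All names occurring in a raw term, i.e. its support. -/
def vars : RawTerm S V → Set V
  | var x => {x}
  | op _ x t => ⋃ i, (Set.range (x i) ∪ vars (t i))

/-- The free names of a raw term; the names in `xᵢ` are bound in `tᵢ`. -/
def fv : RawTerm S V → Set V
  | var x => {x}
  | op _ x t => ⋃ i, (fv (t i) \ Set.range (x i))

end RawTerm

/-- The composition of transpositions `(x¹ z¹) ⋯ (xⁿ zⁿ)`. -/
def transpList {V : Type u} {n : ℕ} (x z : Fin n → V) : FinPerm V :=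
  (List.ofFn fun j => transp (x j) (z j)).prod

/-- α-equivalence of finite raw terms. -/
inductive AlphaEq {S : BindingSignature.{u}} {V : Type u} : RawTerm S V → RawTerm S V → Prop
  | var (x : V) : AlphaEq (RawTerm.var x) (RawTerm.var x)
  | op (f : S.Op) (x y : ∀ i : Fin (S.numArgs f), Fin (S.numBind f i) → V)
      (t s : Fin (S.numArgs f) → RawTerm S V)
      (z : ∀ i : Fin (S.numArgs f), Fin (S.numBind f i) → V)
      (distinct : ∀ i, Function.Injective (z i))
      (fresh : ∀ i j, z i j ∉ (RawTerm.op f x t).vars ∧ z i j ∉ (RawTerm.op f y s).vars)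
      (h : ∀ i, AlphaEq (transpList (x i) (z i) • t i) (transpList (y i) (z i) • s i)) :
      AlphaEq (RawTerm.op f x t) (RawTerm.op f y s)

section AlphaFacts

variable {S : BindingSignature.{u}} {V : Type u}

theorem RawTerm.vars_finite (t : RawTerm S V) : t.vars.Finite := by
  induction t with
  | var x => exact Set.finite_singleton x
  | op f x t ih => exact Set.finite_iUnion fun i => (Set.finite_range _).union (ih i)

theorem RawTerm.fv_subset_vars (t : RawTerm S V) : t.fv ⊆ t.vars := by
  induction t with
  | var x => exact subset_rfl
  | op f x t ih =>
    exact Set.iUnion_mono fun i => Set.sdiff_subset.trans ((ih i).trans Set.subset_union_right)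

theorem RawTerm.fv_finite (t : RawTerm S V) : t.fv.Finite :=
  t.vars_finite.subset t.fv_subset_vars

theorem RawTerm.vars_smul (π : FinPerm V) (t : RawTerm S V) (v : V) :
    π • v ∈ (π • t).vars ↔ v ∈ t.vars := by
  induction t with
  | var x => exact (MulAction.injective π).eq_iff
  | op f x t ih =>
    rw [RawTerm.smul_op]
    simp only [RawTerm.vars, Set.mem_iUnion, Set.mem_union, Set.mem_range, ih,
      (MulAction.injective π).eq_iff]

theorem RawTerm.smul_congr (π ρ : FinPerm V) (t : RawTerm S V)
    (h : ∀ v ∈ t.vars, π • v = ρ • v) : π • t = ρ • t := by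
  induction t with
  | var x => exact congrArg _ (h x rfl)
  | op f x t ih =>
    rw [RawTerm.smul_op, RawTerm.smul_op]
    congr 1
    · funext i j
      exact h _ (Set.mem_iUnion.2 ⟨i, Or.inl ⟨j, rfl⟩⟩)
    · funext i
      exact ih i fun v hv => h v (Set.mem_iUnion.2 ⟨i, Or.inr hv⟩)

theorem transpList_conj {n : ℕ} (π : FinPerm V) (x z : Fin n → V) :
    transpList (fun j => π • x j) (fun j => π • z j) * π = π * transpList x z := by
  unfold transpList
  induction n with
  | zero => simp
  | succ n ih =>
    rw [List.ofFn_succ, List.ofFn_succ, List.prod_cons, List.prod_cons, mul_assoc,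
      ih (fun j => x j.succ) (fun j => z j.succ), ← mul_assoc, transp_conj, mul_assoc]

theorem transp_left (x z : V) : transp x z • x = z := by
  classical
  rw [transp_smul]
  exact Equiv.swap_apply_left x z

theorem transp_other {x z v : V} (h₁ : v ≠ x) (h₂ : v ≠ z) : transp x z • v = v := by
  classical
  rw [transp_smul]
  exact Equiv.swap_apply_of_ne_of_ne h₁ h₂

/-- A list of transpositions with fresh distinct targets sends a name to the target of its last
occurrence, if any. -/
theorem transpList_cases {n : ℕ} (x z : Fin n → V) (hz : Function.Injective z)
    (hxz : ∀ i j, z i ≠ x j) (v : V) (hv : ∀ i, z i ≠ v) :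
    (∃ j, x j = v ∧ transpList x z • v = z j ∧ ∀ k, j < k → x k ≠ v) ∨
      ((∀ j, x j ≠ v) ∧ transpList x z • v = v) := by
  induction n with
  | zero => exact Or.inr ⟨fun j => j.elim0, by simp [transpList]⟩
  | succ n ih =>
    have e : transpList x z • v =
        transp (x 0) (z 0) • transpList (fun j => x j.succ) (fun j => z j.succ) • v := by
      rw [← mul_smul]
      unfold transpList
      rw [List.ofFn_succ, List.prod_cons]
    rcases ih (fun j => x j.succ) (fun j => z j.succ)
        (fun a b h => Fin.succ_injective _ (hz h)) (fun i j => hxz _ _) (fun i => hv _) with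
      ⟨j, hj, he, hl⟩ | ⟨hn, he⟩
    · refine Or.inl ⟨j.succ, hj, ?_, ?_⟩
      · rw [e, he]
        exact transp_other (hxz _ _) (fun h => (Fin.succ_ne_zero j) (hz h))
      · intro k hk
        obtain ⟨k, rfl⟩ := Fin.exists_succ_eq.2 (Fin.ne_of_gt (lt_of_le_of_lt (Fin.zero_le _) hk))
        exact hl k (Fin.succ_lt_succ_iff.1 hk)
    · by_cases h0 : x 0 = v
      · refine Or.inl ⟨0, h0, ?_, ?_⟩
        · rw [e, he, ← h0, transp_left]
        · intro k hk
          obtain ⟨k, rfl⟩ := Fin.exists_succ_eq.2 (Fin.ne_of_gt hk)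
          exact hn k
      · refine Or.inr ⟨fun j => Fin.cases h0 hn j, ?_⟩
        rw [e, he]
        exact transp_other (Ne.symm h0) (Ne.symm (hv 0))

theorem transpList_agree {n : ℕ} {x y z : Fin n → V} (hz : Function.Injective z)
    (hxz : ∀ i j, z i ≠ x j) (hyz : ∀ i j, z i ≠ y j) {v w : V} (hv : ∀ i, z i ≠ v)
    (hw : ∀ i, z i ≠ w) (hvw : ∀ j, x j = v ↔ y j = w) (h : (∀ j, x j ≠ v) → v = w) :
    transpList x z • v = transpList y z • w := by
  rcases transpList_cases x z hz hxz v hv with ⟨j, hj, he, hl⟩ | ⟨hn, he⟩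
  · rcases transpList_cases y z hz hyz w hw with ⟨k, hk, he', hl'⟩ | ⟨hn', he'⟩
    · have : j = k := by
        rcases lt_trichotomy j k with hlt | heq | hlt
        · exact absurd ((hvw k).2 hk) (hl k hlt)
        · exact heq
        · exact absurd ((hvw j).1 hj) (hl' j hlt)
      rw [he, he', this]
    · exact absurd ((hvw j).1 hj) (hn' j)
  · rcases transpList_cases y z hz hyz w hw with ⟨k, hk, he', hl'⟩ | ⟨hn', he'⟩
    · exact absurd ((hvw k).2 hk) (hn k)
    · rw [he, he', h hn]

/-- Renaming the fresh names `z` to fresh names `w`. -/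
theorem transpList_change {n : ℕ} {x z w : Fin n → V} (t : RawTerm S V)
    (hz : Function.Injective z) (hw : Function.Injective w)
    (hzx : ∀ i j, z i ≠ x j) (hwx : ∀ i j, w i ≠ x j) (hzt : ∀ i, z i ∉ t.vars)
    (hwt : ∀ i, w i ∉ t.vars) (hwz : ∀ i j, w i ≠ z j) :
    transpList z w • transpList x z • t = transpList x w • t := by
  rw [← mul_smul]
  refine RawTerm.smul_congr _ _ t fun v hv => ?_
  have hzv : ∀ i, z i ≠ v := fun i h => hzt i (h ▸ hv)
  have hwv : ∀ i, w i ≠ v := fun i h => hwt i (h ▸ hv)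
  rw [mul_smul]
  rcases transpList_cases x z hz hzx v hzv with ⟨j, hj, he, hl⟩ | ⟨hn, he⟩
  · rw [he]
    rcases transpList_cases z w hw hwz (z j) (fun i => hwz i j) with ⟨k, hk, he', -⟩ | ⟨hn', -⟩
    · have hkj : k = j := hz hk
      subst hkj
      rw [he']
      rcases transpList_cases x w hw hwx v hwv with ⟨l, hl', he'', hl''⟩ | ⟨hn'', -⟩
      · rw [he'']
        rcases lt_trichotomy k l with hlt | heq | hlt
        · exact absurd hl' (hl l hlt)
        · rw [heq]
        · exact absurd hj (hl'' k hlt)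
      · exact absurd hj (hn'' k)
    · exact absurd rfl (hn' j)
  · rw [he]
    rcases transpList_cases x w hw hwx v hwv with ⟨l, hl', -, -⟩ | ⟨-, he''⟩
    · exact absurd hl' (hn l)
    · rw [he'']
      rcases transpList_cases z w hw hwz v hwv with ⟨k, hk, -, -⟩ | ⟨-, he'⟩
      · exact absurd hk (hzv k)
      · exact he'

theorem exists_fresh [Infinite V] {A : Set V} (hA : A.Finite) (n : ℕ) :
    ∃ z : Fin n → V, Function.Injective z ∧ ∀ j, z j ∉ A := by
  have : Infinite (Aᶜ : Set V) := hA.infinite_compl.to_subtype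
  refine ⟨fun j => (Infinite.natEmbedding (Aᶜ : Set V) j : V), fun a b h => ?_, fun j => ?_⟩
  · exact Fin.val_injective ((Infinite.natEmbedding _).injective (Subtype.val_injective h))
  · exact (Infinite.natEmbedding (Aᶜ : Set V) j).2

theorem notMem_vars_op {f : S.Op} {x : ∀ i : Fin (S.numArgs f), Fin (S.numBind f i) → V}
    {t : Fin (S.numArgs f) → RawTerm S V} {v : V} (h : v ∉ (RawTerm.op f x t).vars)
    (i : Fin (S.numArgs f)) : (∀ j, v ≠ x i j) ∧ v ∉ (t i).vars :=
  ⟨fun j e => h (Set.mem_iUnion.2 ⟨i, Or.inl ⟨j, e.symm⟩⟩),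
    fun hv => h (Set.mem_iUnion.2 ⟨i, Or.inr hv⟩)⟩

theorem AlphaEq.smul {t s : RawTerm S V} (h : AlphaEq t s) (π : FinPerm V) :
    AlphaEq (π • t) (π • s) := by
  induction h with
  | var x => exact AlphaEq.var _
  | op f x y t s z hd hf _ ih =>
    rw [RawTerm.smul_op, RawTerm.smul_op]
    refine AlphaEq.op f _ _ _ _ (fun i j => π • z i j)
      (fun i a b e => hd i (MulAction.injective π e)) (fun i j => ?_) (fun i => ?_)
    · rw [← RawTerm.smul_op, ← RawTerm.smul_op, RawTerm.vars_smul, RawTerm.vars_smul]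
      exact hf i j
    · have := ih i
      rw [← mul_smul, ← mul_smul, ← transpList_conj, ← transpList_conj, mul_smul, mul_smul] at this
      exact this

/-- Permutations that agree on the free names give α-equivalent terms. -/
theorem AlphaEq.of_agree [Infinite V] (t : RawTerm S V) (π ρ : FinPerm V)
    (h : ∀ v ∈ t.fv, π • v = ρ • v) : AlphaEq (π • t) (ρ • t) := by
  induction t generalizing π ρ with
  | var x =>
    rw [RawTerm.smul_var, RawTerm.smul_var, h x rfl]
    exact AlphaEq.var _
  | op f x t ih =>
    have hA := (π • RawTerm.op f x t).vars_finite.union (ρ • RawTerm.op f x t).vars_finite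
    choose z hz hzA using fun i : Fin (S.numArgs f) => exists_fresh hA (S.numBind f i)
    refine AlphaEq.op f _ _ _ _ z hz
      (fun i j => ⟨fun h => hzA i j (Or.inl h), fun h => hzA i j (Or.inr h)⟩) (fun i => ?_)
    have h1 := fun j => notMem_vars_op (fun h => hzA i j (Or.inl h)) i
    have h2 := fun j => notMem_vars_op (fun h => hzA i j (Or.inr h)) i
    have key := ih i (transpList (fun j => π • x i j) (z i) * π)
      (transpList (fun j => ρ • x i j) (z i) * ρ) (fun v hv => by
        rw [mul_smul, mul_smul]
        have hvt := (t i).fv_subset_vars hv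
        refine transpList_agree (hz i) (fun a b => (h1 a).1 b) (fun a b => (h2 a).1 b)
          (fun a e => (h1 a).2 ?_) (fun a e => (h2 a).2 ?_) (fun j => ?_) (fun hn => ?_)
        · exact e ▸ (RawTerm.vars_smul π (t i) v).2 hvt
        · exact e ▸ (RawTerm.vars_smul ρ (t i) v).2 hvt
        · rw [(MulAction.injective π).eq_iff, (MulAction.injective ρ).eq_iff]
        · refine h v (Set.mem_iUnion.2 ⟨i, hv, ?_⟩)
          rintro ⟨j, rfl⟩
          exact hn j rfl)
    rw [mul_smul, mul_smul] at key
    exact key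

theorem AlphaEq.refl [Infinite V] (t : RawTerm S V) : AlphaEq t t := by
  have := AlphaEq.of_agree t 1 1 (fun _ _ => rfl)
  rwa [one_smul] at this

theorem AlphaEq.symm {t s : RawTerm S V} (h : AlphaEq t s) : AlphaEq s t := by
  induction h with
  | var x => exact AlphaEq.var x
  | op f x y t s z hd hf _ ih => exact AlphaEq.op f y x s t z hd (fun i j => (hf i j).symm) ih

theorem AlphaEq.trans [Infinite V] {t s r : RawTerm S V} (h : AlphaEq t s) (h' : AlphaEq s r) :
    AlphaEq t r := by
  induction h generalizing r with
  | var x => exact h'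
  | op f x y t s z hd hf _ ih =>
    cases h' with
    | op _ _ u _ r z' hd' hf' h' =>
      have hA := (((RawTerm.op f x t).vars_finite.union (RawTerm.op f y s).vars_finite).union
        (RawTerm.op f u r).vars_finite).union
        ((Set.finite_iUnion fun i => Set.finite_range (z i)).union
          (Set.finite_iUnion fun i => Set.finite_range (z' i)))
      choose w hw hwA using fun i : Fin (S.numArgs f) => exists_fresh hA (S.numBind f i)
      refine AlphaEq.op f _ _ _ _ w hw (fun i j => ⟨fun h => hwA i j (Or.inl (Or.inl (Or.inl h))),
        fun h => hwA i j (Or.inl (Or.inr h))⟩) (fun i => ?_)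
      have w1 := fun j => notMem_vars_op (fun h => hwA i j (Or.inl (Or.inl (Or.inl h)))) i
      have w2 := fun j => notMem_vars_op (fun h => hwA i j (Or.inl (Or.inl (Or.inr h)))) i
      have w3 := fun j => notMem_vars_op (fun h => hwA i j (Or.inl (Or.inr h))) i
      have w4 : ∀ j k, w i j ≠ z i k := fun j k e =>
        hwA i j (Or.inr (Or.inl (Set.mem_iUnion.2 ⟨i, k, e.symm⟩)))
      have w5 : ∀ j k, w i j ≠ z' i k := fun j k e =>
        hwA i j (Or.inr (Or.inr (Set.mem_iUnion.2 ⟨i, k, e.symm⟩)))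
      have z1 := fun j => notMem_vars_op (hf i j).1 i
      have z2 := fun j => notMem_vars_op (hf i j).2 i
      have z3 := fun j => notMem_vars_op (hf' i j).1 i
      have z4 := fun j => notMem_vars_op (hf' i j).2 i
      have a1 := (h' i).smul (transpList (z' i) (w i))
      rw [transpList_change (s i) (hd' i) (hw i) (fun a b => (z3 a).1 b) (fun a b => (w2 a).1 b)
          (fun a => (z3 a).2) (fun a => (w2 a).2) w5,
        transpList_change (r i) (hd' i) (hw i) (fun a b => (z4 a).1 b) (fun a b => (w3 a).1 b)
          (fun a => (z4 a).2) (fun a => (w3 a).2) w5] at a1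
      have a2 := a1.smul (transpList (w i) (z i))
      rw [transpList_change (s i) (hw i) (hd i) (fun a b => (w2 a).1 b) (fun a b => (z2 a).1 b)
          (fun a => (w2 a).2) (fun a => (z2 a).2) (fun a b => (w4 b a).symm)] at a2
      have a3 := ih i a2
      rw [← transpList_change (t i) (hw i) (hd i) (fun a b => (w1 a).1 b) (fun a b => (z1 a).1 b)
          (fun a => (w1 a).2) (fun a => (z1 a).2) (fun a b => (w4 b a).symm)] at a3
      have a4 := a3.smul (transpList (w i) (z i))⁻¹
      rwa [inv_smul_smul, inv_smul_smul] at a4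

end AlphaFacts

/-- The set `T_Σ/=_α` of α-equivalence classes of finite raw terms. -/
def alphaSetoid (S : BindingSignature.{u}) (V : Type u) [Infinite V] : Setoid (RawTerm S V) :=
  ⟨AlphaEq, AlphaEq.refl, AlphaEq.symm, AlphaEq.trans⟩

/-- The set `T_Σ/=_α` of α-equivalence classes of finite raw terms. -/
def TermClass (S : BindingSignature.{u}) (V : Type u) [Infinite V] : Type u :=
  Quotient (alphaSetoid S V)

namespace TermClass

variable {S : BindingSignature.{u}} {V : Type u} [Infinite V]

/-- The α-equivalence class `[t]_α`. -/
def mk (t : RawTerm S V) : TermClass S V := Quotient.mk (alphaSetoid S V) t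

theorem mk_eq_mk {t s : RawTerm S V} : mk t = mk s ↔ AlphaEq t s :=
  Quotient.eq (r := alphaSetoid S V)

instance : MulAction (FinPerm V) (TermClass S V) where
  smul π := Quotient.map (fun t => π • t) (fun _ _ h => AlphaEq.smul h π)
  one_smul := by
    rintro ⟨t⟩
    exact congrArg mk (one_smul _ t)
  mul_smul := by
    rintro π ρ ⟨t⟩
    exact congrArg mk (mul_smul π ρ t)

theorem smul_mk (π : FinPerm V) (t : RawTerm S V) : π • mk t = mk (π • t) := rfl

theorem supports_mk (t : RawTerm S V) : MulAction.Supports (FinPerm V) t.fv (mk t) := by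
  intro π hπ
  rw [smul_mk, mk_eq_mk]
  have := AlphaEq.of_agree t π 1 (fun v hv => by rw [hπ hv, one_smul])
  rwa [one_smul] at this

end TermClass

/-! ### Infinitary raw terms and truncation -/

namespace BindingSignature

/-- The signature with an additional constant `*`. -/
def withStar (S : BindingSignature.{u}) : BindingSignature.{u} where
  Op := Option S.Op
  ar o := o.elim [] S.ar

end BindingSignature

/-- The constant `*`. -/
def star (S : BindingSignature.{u}) (V : Type u) : RawTerm S.withStar V :=
  RawTerm.op (S := S.withStar) none (fun i => Fin.elim0 i) (fun i => Fin.elim0 i)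

/-- The polynomial functor `X ↦ V + ∐_op (V^{n₁} × X) × … × (V^{n_k} × X)` on sets. -/
def termPFunctor (S : BindingSignature.{u}) (V : Type u) : PFunctor.{u, 0} where
  A := V ⊕ (Σ f : S.Op, ∀ i : Fin (S.numArgs f), Fin (S.numBind f i) → V)
  B a := a.elim (fun _ => Empty) (fun p => Fin (S.numArgs p.1))

/-- The set `T_Σ^∞` of infinitary raw terms, the final coalgebra of the functor above. -/
def InfTerm (S : BindingSignature.{u}) (V : Type u) : Type u := (termPFunctor S V).M

namespace InfTerm

variable {S : BindingSignature.{u}} {V : Type u}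

def var (x : V) : InfTerm S V := PFunctor.M.mk ⟨Sum.inl x, fun e : Empty => e.elim⟩

def op (f : S.Op) (x : ∀ i : Fin (S.numArgs f), Fin (S.numBind f i) → V)
    (t : Fin (S.numArgs f) → InfTerm S V) : InfTerm S V :=
  PFunctor.M.mk ⟨Sum.inr ⟨f, x⟩, t⟩

end InfTerm

variable {S : BindingSignature.{u}} {V : Type u}

/-- The inclusion `T_Σ → T_Σ^∞`. -/
def RawTerm.toInf : RawTerm S V → InfTerm S V
  | .var x => InfTerm.var x
  | .op f x t => InfTerm.op f x (fun i => (t i).toInf)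

/-- The truncation `tⁿ` of an infinitary raw term, with `*` at depth `n`. -/
def InfTerm.trunc : ℕ → InfTerm S V → RawTerm S.withStar V
  | 0, _ => star S V
  | n + 1, t =>
    match PFunctor.M.dest t with
    | ⟨Sum.inl x, _⟩ => RawTerm.var x
    | ⟨Sum.inr ⟨f, x⟩, c⟩ => RawTerm.op (S := S.withStar) (some f) x (fun i => trunc n (c i))

theorem InfTerm.var_or_op (t : InfTerm S V) :
    (∃ x, t = InfTerm.var x) ∨ ∃ f x c, t = InfTerm.op f x c := by
  rcases h : PFunctor.M.dest t with ⟨x | ⟨f, x⟩, c⟩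
  · refine Or.inl ⟨x, ?_⟩
    rw [← PFunctor.M.mk_dest t, h]
    exact congrArg (fun c : Empty → (termPFunctor S V).M =>
      PFunctor.M.mk (F := termPFunctor S V) ⟨Sum.inl x, c⟩) (funext fun e : Empty => e.elim)
  · refine Or.inr ⟨f, x, c, ?_⟩
    rw [← PFunctor.M.mk_dest t, h]
    rfl

theorem InfTerm.trunc_var (n : ℕ) (x : V) :
    (InfTerm.var x : InfTerm S V).trunc (n + 1) = RawTerm.var x := rfl

theorem InfTerm.trunc_op (n : ℕ) (f : S.Op)
    (x : ∀ i : Fin (S.numArgs f), Fin (S.numBind f i) → V) (t : Fin (S.numArgs f) → InfTerm S V) :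
    (InfTerm.op f x t).trunc (n + 1) =
      RawTerm.op (S := S.withStar) (some f) x (fun i => (t i).trunc n) := rfl

/-- The truncation `tⁿ` of a finite raw term. -/
def RawTerm.trunc : ℕ → RawTerm S V → RawTerm S.withStar V
  | 0, _ => star S V
  | _ + 1, .var x => RawTerm.var x
  | n + 1, .op f x t => RawTerm.op (S := S.withStar) (some f) x (fun i => trunc n (t i))

theorem RawTerm.trunc_toInf (n : ℕ) (t : RawTerm S V) : t.toInf.trunc n = t.trunc n := by
  induction n generalizing t with
  | zero => rfl
  | succ n ih =>
    cases t with
    | var x => rfl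
    | op f x t =>
      exact congrArg (RawTerm.op (S := S.withStar) (some f) x) (funext fun i => ih (t i))

/-- The free names of an infinitary raw term. -/
def InfTerm.fv (t : InfTerm S V) : Set V := ⋃ n, (t.trunc n).fv

/-- α-equivalence of infinitary raw terms. -/
def InfAlphaEq (t s : InfTerm S V) : Prop := ∀ n, AlphaEq (t.trunc n) (s.trunc n)

/-- `(T_Σ^∞)_ffv`: the infinitary raw terms with finitely many free names. -/
def FfvTerm (S : BindingSignature.{u}) (V : Type u) : Type u := {t : InfTerm S V // t.fv.Finite}

theorem RawTerm.fv_trunc_subset (n : ℕ) (t : RawTerm S V) : (t.trunc n).fv ⊆ t.fv := by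
  induction n generalizing t with
  | zero =>
    intro v hv
    obtain ⟨i, -⟩ := Set.mem_iUnion.1 hv
    exact i.elim0
  | succ n ih =>
    cases t with
    | var x => exact subset_rfl
    | op f x t => exact Set.iUnion_mono fun i => Set.sdiff_subset_sdiff_left (ih (t i))

theorem RawTerm.toInf_fv_finite (t : RawTerm S V) : t.toInf.fv.Finite :=
  t.fv_finite.subset (Set.iUnion_subset fun n => by
    rw [RawTerm.trunc_toInf]
    exact RawTerm.fv_trunc_subset n t)

/-- The inclusion `T_Σ → (T_Σ^∞)_ffv`. -/
def RawTerm.toFfv (t : RawTerm S V) : FfvTerm S V := ⟨t.toInf, t.toInf_fv_finite⟩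

/-! ### Metrics and completion -/

section Metric

variable {X : Type u} (r : ℕ → X → X → Prop)

/-- `d(x,y) = inf {2⁻ⁿ ∣ x and y agree at depth n}`. -/
def depthDist (x y : X) : ℝ := sInf {a : ℝ | ∃ n : ℕ, r n x y ∧ a = (1 / 2 : ℝ) ^ n}

theorem depthDist_bdd (x y : X) : BddBelow {a : ℝ | ∃ n : ℕ, r n x y ∧ a = (1 / 2 : ℝ) ^ n} :=
  ⟨0, by rintro _ ⟨n, -, rfl⟩; positivity⟩

theorem depthDist_le {x y : X} {n : ℕ} (h : r n x y) : depthDist r x y ≤ (1 / 2 : ℝ) ^ n :=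
  csInf_le (depthDist_bdd r x y) ⟨n, h, rfl⟩

theorem depthDist_nonneg (x y : X) : 0 ≤ depthDist r x y :=
  Real.sInf_nonneg (by rintro _ ⟨n, -, rfl⟩; positivity)

theorem rel_of_depthDist_lt (h0 : ∀ x y, r 0 x y) (hr : ∀ n x y, r (n + 1) x y → r n x y)
    {x y : X} {n : ℕ} (h : depthDist r x y < (1 / 2 : ℝ) ^ n) : r n x y := by
  obtain ⟨_, ⟨m, hm, rfl⟩, hlt⟩ := exists_lt_of_csInf_lt (s := {a : ℝ | ∃ n : ℕ, r n x y ∧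
    a = (1 / 2 : ℝ) ^ n}) ⟨_, 0, h0 x y, rfl⟩ h
  have hnm : n < m := (pow_lt_pow_iff_right_of_lt_one₀ (by norm_num) (by norm_num)).1 hlt
  exact Nat.decreasingInduction' (P := fun k => r k x y) (fun k _ _ hk => hr k x y hk) hnm.le hm

/-- The (pseudo)metric given by agreement at all depths. -/
@[reducible] def depthMetric (h0 : ∀ x y, r 0 x y) (hr : ∀ n x y, r (n + 1) x y → r n x y)
    (he : ∀ n, Equivalence (r n)) : PseudoMetricSpace X where
  dist := depthDist r
  dist_self x := by
    refine le_antisymm (le_of_forall_pos_le_add fun ε hε => ?_) (depthDist_nonneg r x x)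
    obtain ⟨n, hn⟩ := exists_pow_lt_of_lt_one hε (by norm_num : (1 / 2 : ℝ) < 1)
    linarith [depthDist_le r ((he n).refl x)]
  dist_comm x y := by
    have : ∀ n, r n x y ↔ r n y x := fun n => ⟨(he n).symm, (he n).symm⟩
    simp only [depthDist, this]
  dist_triangle x y z := by
    refine le_of_forall_pos_le_add fun ε hε => ?_
    obtain ⟨_, ⟨m, hm, rfl⟩, h1⟩ := Real.lt_sInf_add_pos (s := {a : ℝ | ∃ n : ℕ, r n x y ∧
      a = (1 / 2 : ℝ) ^ n}) ⟨_, 0, h0 x y, rfl⟩ (half_pos hε)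
    obtain ⟨_, ⟨n, hn, rfl⟩, h2⟩ := Real.lt_sInf_add_pos (s := {a : ℝ | ∃ n : ℕ, r n y z ∧
      a = (1 / 2 : ℝ) ^ n}) ⟨_, 0, h0 y z, rfl⟩ (half_pos hε)
    change (1 / 2 : ℝ) ^ m < depthDist r x y + ε / 2 at h1
    change (1 / 2 : ℝ) ^ n < depthDist r y z + ε / 2 at h2
    have p1 : (0 : ℝ) < (1 / 2) ^ m := by positivity
    have p2 : (0 : ℝ) < (1 / 2) ^ n := by positivity
    have mono : ∀ {a b : X} {k l : ℕ}, k ≤ l → r l a b → r k a b := fun {a b k l} hkl hl =>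
      Nat.decreasingInduction' (P := fun k => r k a b) (fun k _ _ hk => hr k a b hk) hkl hl
    rcases le_total m n with hmn | hmn
    · have := depthDist_le r ((he m).trans hm (mono hmn hn))
      linarith
    · have := depthDist_le r ((he n).trans (mono hmn hm) hn)
      linarith

end Metric

theorem InfTerm.trunc_succ_eq (n : ℕ) (t s : InfTerm S V) (h : t.trunc (n + 1) = s.trunc (n + 1)) :
    t.trunc n = s.trunc n := by
  induction n generalizing t s with
  | zero => rfl
  | succ n ih =>
    rcases t.var_or_op with ⟨x, rfl⟩ | ⟨f, x, c, rfl⟩ <;>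
      rcases s.var_or_op with ⟨y, rfl⟩ | ⟨g, y, d, rfl⟩
    · exact h
    · cases h
    · cases h
    · rw [InfTerm.trunc_op, InfTerm.trunc_op] at h ⊢
      injection h with h1 h2 h3
      injection h1 with h1
      subst h1
      rw [eq_of_heq h2]
      congr 1
      funext i
      exact ih _ _ (congrFun (eq_of_heq h3) i)

theorem InfTerm.trunc_eq_of_le {m n : ℕ} (h : m ≤ n) {t s : InfTerm S V}
    (e : t.trunc n = s.trunc n) : t.trunc m = s.trunc m :=
  Nat.decreasingInduction' (P := fun k => t.trunc k = s.trunc k)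
    (fun k _ _ hk => InfTerm.trunc_succ_eq k t s hk) h e

/-- The metric `d(t,s) = 2^{-sup {n ∣ tⁿ = sⁿ}}` on infinitary raw terms. -/
instance : PseudoMetricSpace (InfTerm S V) :=
  depthMetric (fun n t s => t.trunc n = s.trunc n) (fun _ _ => rfl) InfTerm.trunc_succ_eq
    (fun _ => ⟨fun _ => rfl, Eq.symm, Eq.trans⟩)

theorem RawTerm.trunc_smul (π : FinPerm V) (n : ℕ) (t : RawTerm S V) :
    (π • t).trunc n = π • t.trunc n := by
  induction n generalizing t with
  | zero =>
    change RawTerm.op _ _ _ = RawTerm.op _ _ _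
    congr 1 <;> exact funext fun i => i.elim0
  | succ n ih =>
    cases t with
    | var x => rfl
    | op f x t =>
      exact congrArg (RawTerm.op (S := S.withStar) (some f) _) (funext fun i => ih (t i))

theorem RawTerm.vars_trunc_subset (n : ℕ) (t : RawTerm S V) : (t.trunc n).vars ⊆ t.vars := by
  induction n generalizing t with
  | zero =>
    intro v hv
    obtain ⟨i, -⟩ := Set.mem_iUnion.1 hv
    exact i.elim0
  | succ n ih =>
    cases t with
    | var x => exact subset_rfl
    | op f x t => exact Set.iUnion_mono fun i => Set.union_subset_union_right _ (ih (t i))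

theorem RawTerm.vars_trunc_succ (n : ℕ) (t : RawTerm S V) :
    (t.trunc n).vars ⊆ (t.trunc (n + 1)).vars := by
  induction n generalizing t with
  | zero =>
    intro v hv
    obtain ⟨i, -⟩ := Set.mem_iUnion.1 hv
    exact i.elim0
  | succ n ih =>
    cases t with
    | var x => exact subset_rfl
    | op f x t => exact Set.iUnion_mono fun i => Set.union_subset_union_right _ (ih (t i))

section Completion

variable [Infinite V]

theorem AlphaEq.trunc {t s : RawTerm S V} (h : AlphaEq t s) (n : ℕ) :
    AlphaEq (t.trunc n) (s.trunc n) := by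
  induction h generalizing n with
  | var x => exact AlphaEq.refl _
  | op f x y t s z hd hf _ ih =>
    cases n with
    | zero => exact AlphaEq.refl _
    | succ n =>
      refine AlphaEq.op (S := S.withStar) (some f) x y _ _ z hd (fun i j =>
        ⟨fun hv => (hf i j).1 (RawTerm.vars_trunc_subset (n + 1) (RawTerm.op f x t) hv),
        fun hv => (hf i j).2 (RawTerm.vars_trunc_subset (n + 1) (RawTerm.op f y s) hv)⟩)
        (fun i => ?_)
      have := ih i n
      rwa [RawTerm.trunc_smul, RawTerm.trunc_smul] at this

theorem alphaEq_of_trunc_succ (n : ℕ) (t s : RawTerm S V)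
    (h : AlphaEq (t.trunc (n + 1)) (s.trunc (n + 1))) : AlphaEq (t.trunc n) (s.trunc n) := by
  induction n generalizing t s with
  | zero => exact AlphaEq.refl _
  | succ n ih =>
    cases t with
    | var x =>
      cases s with
      | var y => exact h
      | op g y s => cases h
    | op f x t =>
      cases s with
      | var y => cases h
      | op g y s =>
        cases h with
        | op _ _ y _ _ z hd hf h =>
          refine AlphaEq.op (S := S.withStar) (some f) x y _ _ z hd (fun i j =>
            ⟨fun hv => (hf i j).1 (RawTerm.vars_trunc_succ (n + 1) (RawTerm.op f x t) hv),
            fun hv => (hf i j).2 (RawTerm.vars_trunc_succ (n + 1) (RawTerm.op f y s) hv)⟩)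
            (fun i => ?_)
          have := h i
          rw [← RawTerm.trunc_smul, ← RawTerm.trunc_smul] at this
          have := ih _ _ this
          rwa [RawTerm.trunc_smul, RawTerm.trunc_smul] at this

/-- The truncation `[t]_αⁿ = [tⁿ]_α` of an α-equivalence class. -/
def TermClass.trunc (n : ℕ) : TermClass S V → TermClass S.withStar V :=
  Quotient.map (RawTerm.trunc n) (fun _ _ h => AlphaEq.trunc h n)

theorem TermClass.trunc_mk (n : ℕ) (t : RawTerm S V) :
    TermClass.trunc n (TermClass.mk t) = TermClass.mk (t.trunc n) := rfl

theorem TermClass.trunc_zero (a b : TermClass S V) : a.trunc 0 = b.trunc 0 := by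
  obtain ⟨t⟩ := a
  obtain ⟨s⟩ := b
  rfl

theorem TermClass.trunc_succ_eq (n : ℕ) (a b : TermClass S V)
    (h : a.trunc (n + 1) = b.trunc (n + 1)) : a.trunc n = b.trunc n := by
  obtain ⟨t⟩ := a
  obtain ⟨s⟩ := b
  exact TermClass.mk_eq_mk.2 (alphaEq_of_trunc_succ n t s (TermClass.mk_eq_mk.1 h))

theorem TermClass.trunc_smul (π : FinPerm V) (n : ℕ) (a : TermClass S V) :
    (π • a).trunc n = π • a.trunc n := by
  obtain ⟨t⟩ := a
  exact congrArg TermClass.mk (RawTerm.trunc_smul π n t)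

/-- The metric `d_α([t]_α,[s]_α) = inf {2⁻ⁿ ∣ tⁿ =_α sⁿ}`. -/
instance : PseudoMetricSpace (TermClass S V) :=
  depthMetric (fun n a b => a.trunc n = b.trunc n) TermClass.trunc_zero TermClass.trunc_succ_eq
    (fun _ => ⟨fun _ => rfl, Eq.symm, Eq.trans⟩)

theorem TermClass.dist_le {n : ℕ} {a b : TermClass S V} (h : a.trunc n = b.trunc n) :
    dist a b ≤ (1 / 2 : ℝ) ^ n :=
  depthDist_le (fun n a b => TermClass.trunc n a = TermClass.trunc n b) h

theorem TermClass.isometry_smul (π : FinPerm V) :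
    Isometry fun a : TermClass S V => π • a := Isometry.of_dist_eq fun a b => by
  change depthDist _ _ _ = depthDist _ _ _
  simp only [depthDist, TermClass.trunc_smul, (MulAction.injective π).eq_iff]

instance : UniformContinuousConstSMul (FinPerm V) (TermClass S V) :=
  ⟨fun π => (TermClass.isometry_smul π).uniformContinuous⟩

instance : Nonempty (TermClass S V) := ⟨TermClass.mk (RawTerm.var (Classical.arbitrary V))⟩

/-- The metric completion `(T_Σ/=_α)^∞`, with the canonical action extending that on
`T_Σ/=_α` by uniform continuity. -/
abbrev ClassCompletion (S : BindingSignature.{u}) (V : Type u) [Infinite V] : Type u :=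
  UniformSpace.Completion (TermClass S V)

instance : Nonempty (ClassCompletion S V) :=
  ⟨((TermClass.mk (RawTerm.var (Classical.arbitrary V)) : TermClass S V) : ClassCompletion S V)⟩

/-- `((T_Σ/=_α)^∞)_fs`: the finitely supported elements of the completion. -/
def FsClass (S : BindingSignature.{u}) (V : Type u) [Infinite V] : Type u :=
  {a : ClassCompletion S V // FinSupp V a}

theorem TermClass.supports_coe (t : RawTerm S V) :
    MulAction.Supports (FinPerm V) t.fv (TermClass.mk t : ClassCompletion S V) := by
  intro π hπ
  rw [← UniformSpace.Completion.coe_smul, TermClass.supports_mk t π hπ]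

/-- The inclusion `T_Σ/=_α → ((T_Σ/=_α)^∞)_fs`. -/
def TermClass.toFs (a : TermClass S V) : FsClass S V :=
  ⟨(a : ClassCompletion S V), by
    obtain ⟨t⟩ := a
    exact ⟨t.fv, t.fv_finite, TermClass.supports_coe t⟩⟩

/-- The finite raw term obtained from the truncation `tⁿ` by replacing `*` with a fixed name. -/
def InfTerm.approx : ℕ → InfTerm S V → RawTerm S V
  | 0, _ => RawTerm.var (Classical.arbitrary V)
  | n + 1, t =>
    match PFunctor.M.dest t with
    | ⟨Sum.inl x, _⟩ => RawTerm.var x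
    | ⟨Sum.inr ⟨f, x⟩, c⟩ => RawTerm.op f x (fun i => approx n (c i))

theorem InfTerm.trunc_approx (n : ℕ) (t : InfTerm S V) : (t.approx n).trunc n = t.trunc n := by
  induction n generalizing t with
  | zero => rfl
  | succ n ih =>
    rcases t.var_or_op with ⟨x, rfl⟩ | ⟨f, x, c, rfl⟩
    · rfl
    · exact congrArg (RawTerm.op (S := S.withStar) (some f) x) (funext fun i => ih (c i))

theorem InfTerm.fv_approx_subset (n : ℕ) (t : InfTerm S V) :
    (t.approx n).fv ⊆ (t.trunc n).fv ∪ {Classical.arbitrary V} := by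
  induction n generalizing t with
  | zero => exact Set.subset_union_right
  | succ n ih =>
    rcases t.var_or_op with ⟨x, rfl⟩ | ⟨f, x, c, rfl⟩
    · exact Set.subset_union_left
    · intro v hv
      obtain ⟨i, hv, hx⟩ := Set.mem_iUnion.1 hv
      rcases ih (c i) hv with h | h
      · exact Or.inl (Set.mem_iUnion.2 ⟨i, h, hx⟩)
      · exact Or.inr h

theorem InfTerm.trunc_approx_of_le {m n : ℕ} (h : m ≤ n) (t : InfTerm S V) :
    (t.approx n).trunc m = t.trunc m := by
  rw [← RawTerm.trunc_toInf]
  refine InfTerm.trunc_eq_of_le h ?_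
  rw [RawTerm.trunc_toInf, InfTerm.trunc_approx]

/-- The map `[-]_α : T_Σ^∞ → (T_Σ/=_α)^∞`, extending `T_Σ → T_Σ/=_α` to limits of finite terms:
`t` is the limit of the finite terms `t.approx n`, and `[t]_α` is the limit of their classes. -/
def InfTerm.cls (t : InfTerm S V) : ClassCompletion S V :=
  limUnder atTop fun n => (TermClass.mk (t.approx n) : ClassCompletion S V)

theorem InfTerm.tendsto_approx (t : InfTerm S V) :
    Tendsto (fun n => (TermClass.mk (t.approx n) : ClassCompletion S V)) atTop (𝓝 t.cls) := by
  have h : CauchySeq fun n => TermClass.mk (t.approx n) := by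
    refine cauchySeq_of_le_geometric (1 / 2) 1 (by norm_num) fun n => ?_
    rw [one_mul]
    refine TermClass.dist_le ?_
    rw [TermClass.trunc_mk, TermClass.trunc_mk, InfTerm.trunc_approx,
      InfTerm.trunc_approx_of_le n.le_succ]
  exact CauchySeq.tendsto_limUnder
    ((UniformSpace.Completion.uniformContinuous_coe (TermClass S V)).comp_cauchySeq h)

/-- `[t]_α` is the limit of `[sₖ]_α` for every sequence of finite terms `sₖ` with limit `t`. -/
theorem InfTerm.tendsto_cls {t : InfTerm S V} {s : ℕ → RawTerm S V}
    (h : Tendsto (fun k => (s k).toInf) atTop (𝓝 t)) :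
    Tendsto (fun k => (TermClass.mk (s k) : ClassCompletion S V)) atTop (𝓝 t.cls) := by
  refine t.tendsto_approx.congr_dist ?_
  refine Metric.tendsto_atTop.2 fun ε hε => ?_
  obtain ⟨n, hn⟩ := exists_pow_lt_of_lt_one hε (by norm_num : (1 / 2 : ℝ) < 1)
  obtain ⟨N, hN⟩ := Metric.tendsto_atTop.1 h ((1 / 2 : ℝ) ^ n) (by positivity)
  refine ⟨max N n, fun k hk => ?_⟩
  rw [Real.dist_0_eq_abs, abs_of_nonneg dist_nonneg, UniformSpace.Completion.dist_eq]
  refine lt_of_le_of_lt (TermClass.dist_le ?_) hn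
  have e : (s k).toInf.trunc n = t.trunc n :=
    rel_of_depthDist_lt (fun n t s => InfTerm.trunc n t = InfTerm.trunc n s) (fun _ _ => rfl)
      InfTerm.trunc_succ_eq (hN k (le_trans (le_max_left _ _) hk))
  rw [TermClass.trunc_mk, TermClass.trunc_mk, InfTerm.trunc_approx_of_le
    (le_trans (le_max_right _ _) hk), ← e, RawTerm.trunc_toInf]

/-- The map `[-]_α : (T_Σ^∞)_ffv → ((T_Σ/=_α)^∞)_fs`. -/
def FfvTerm.cls (t : FfvTerm S V) : FsClass S V :=
  ⟨t.1.cls, t.1.fv ∪ {Classical.arbitrary V}, t.2.union (Set.finite_singleton _), fun π hπ => by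
    have h := t.1.tendsto_approx
    refine tendsto_nhds_unique ((continuous_const_smul π).continuousAt.tendsto.comp h) ?_
    refine h.congr fun n => ((TermClass.supports_coe (t.1.approx n)) π fun v hv => hπ ?_).symm
    rcases InfTerm.fv_approx_subset n t.1 hv with hv | hv
    · exact Or.inl (Set.mem_iUnion.2 ⟨n, hv⟩)
    · exact Or.inr hv⟩

end Completion

end

noncomputable section

/-! ### Supports, abstraction and renaming of bound names. -/

section NominalFacts

variable {V : Type u}

/-! Every object of the theorem is compared with the limit of a terminal sequence, and every
equality is tested level by level there.

On the semantic side, abstraction preserves limits of sequences of nominal sets. In such a limit a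
coherent sequence has a common finite support, so one name `z` is fresh for all its members, each
member is `⟨z⟩a` for a unique `a`, and the bodies form a coherent sequence again
(`preservesSeqLimits_absFunctor`). Hence `F` and `F_α` preserve these limits, and their final
coalgebras consist of the coherent sequences in `Fⁿ1`, respectively `F_αⁿ1`, with a common finite
support (`isSeqLimit_of_isTerminal`).

On the syntactic side, infinitary raw terms are all coherent sequences in `Fⁿ1`, with no condition
on supports (`InfTerm.equivLim`). The rule `AlphaEq.op` says exactly that the tuples of iterated
abstractions agree (`alphaEq_op_iff`), so `T_Σ/=_α` is the initial `F_α`-algebra, and `F_αⁿ1` embeds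
into classes of terms with `*` (`iterToClass_injective`). It follows that two terms have the same
image in `F_αⁿ1` iff their truncations at depth `n` are α-equivalent (`InfTerm.projα_eq_iff`). This
also yields equivariant and jointly injective maps `classProj` from the metric completion to
`F_αⁿ1`.

Two facts then give the theorem. First, the free names of a finite term lie in every finite support
of its class, and they support it. So an infinitary term has finitely many free names iff its images
in `F_αⁿ1` have a common finite support, which identifies `P` with the terms with finitely many free
names (`exists_pullback_equiv`). Secondly, a section of the surjection `q`, chosen without regard to
equivariance, unfolds any element of an `F_α`-coalgebra to an infinitary raw term
(`exists_projα_eq_cone`). Its bound names may be infinitely many, so it need not come from `T`, but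
its free names lie in a finite support of the element, so it lies in `P`. Surjectivity follows, and
so does the bijection of `U T_α` with the finitely supported part of the completion
(`exists_final_equiv`). -/

theorem smul_eq_of_agree {X : Type u} [MulAction (FinPerm V) X] {A : Set V} {a : X}
    (h : MulAction.Supports (FinPerm V) A a) {π ρ : FinPerm V} (e : ∀ v ∈ A, π • v = ρ • v) :
    π • a = ρ • a := by
  have := h (ρ⁻¹ * π) (fun v hv => by rw [mul_smul, e v hv, inv_smul_smul])
  rwa [mul_smul, inv_smul_eq_iff] at this

/-- Renaming `x` to `z` and then `z` to `w`, for fresh `z` and `w`. -/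
theorem transp_change {X : Type u} [MulAction (FinPerm V) X] {A : Set V} {a : X}
    (h : MulAction.Supports (FinPerm V) A a) {x z w : V} (hz : z ∉ A) (hw : w ∉ A) (hwx : w ≠ x) :
    transp z w • transp x z • a = transp x w • a := by
  rw [← mul_smul]
  refine smul_eq_of_agree h fun v hv => ?_
  have hvz : v ≠ z := fun e => hz (e ▸ hv)
  have hvw : v ≠ w := fun e => hw (e ▸ hv)
  rw [mul_smul]
  by_cases hvx : v = x
  · subst hvx
    rw [transp_left, transp_left, transp_left]
  · rw [transp_other hvx hvz, transp_other hvz hvw, transp_other hvx hvw]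

theorem exists_support {X : Nom V} (a : X) :
    ∃ A : Set V, A.Finite ∧ MulAction.Supports (FinPerm V) A a := X.finSupp a

theorem supports_smul {X : Type u} [MulAction (FinPerm V) X] {A : Set V} {a : X}
    (h : MulAction.Supports (FinPerm V) A a) (σ : FinPerm V) :
    MulAction.Supports (FinPerm V) ((fun v => σ • v) '' A) (σ • a) := by
  intro π hπ
  rw [← mul_smul]
  exact smul_eq_of_agree h fun v hv => by rw [mul_smul, hπ ⟨v, hv, rfl⟩]

theorem notMem_nsupp_of_supports {X : Type u} [MulAction (FinPerm V) X] {A : Set V} {a : X}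
    (hA : A.Finite) (h : MulAction.Supports (FinPerm V) A a) {z : V} (hz : z ∉ A) :
    z ∉ nsupp V a := (notMem_nsupp_iff a z).2 ⟨A, hA, h, hz⟩

theorem supports_mono {X : Type u} [MulAction (FinPerm V) X] {A B : Set V} {a : X}
    (h : MulAction.Supports (FinPerm V) A a) (hAB : A ⊆ B) :
    MulAction.Supports (FinPerm V) B a := fun π hπ => h π fun _ hv => hπ (hAB hv)

theorem absMk_surjective {X : Nom V} (c : X.abs) : ∃ x a, c = absMk x a := by
  obtain ⟨x, a⟩ := c
  exact ⟨x, a, rfl⟩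

theorem supports_absMany {X : Nom V} {A : Set V} {a : X}
    (h : MulAction.Supports (FinPerm V) A a) : ∀ (n : ℕ) (x : Fin n → V),
    MulAction.Supports (FinPerm V) (Set.range x ∪ A) (absMany n x a) := by
  intro n x π hπ
  rw [← absMany_smul, h π fun v hv => hπ (Or.inr hv)]
  congr 1
  funext j
  exact hπ (Or.inl ⟨j, rfl⟩)

theorem transpList_succ {n : ℕ} (x z : Fin (n + 1) → V) :
    transpList x z = transp (x 0) (z 0) * transpList (Fin.tail x) (Fin.tail z) := by
  unfold transpList
  rw [List.ofFn_succ, List.prod_cons]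
  rfl

/-- Equivariant maps factor through surjective equivariant maps with smaller kernel. -/
theorem Nom.exists_factor {X Y Z : Nom V} (f : X ⟶ Y) (g : X ⟶ Z)
    (hf : Function.Surjective (Nom.fn f))
    (h : ∀ a b, Nom.fn f a = Nom.fn f b → Nom.fn g a = Nom.fn g b) :
    ∃ k : Y ⟶ Z, ∀ a, Nom.fn k (Nom.fn f a) = Nom.fn g a := by
  -- The section `s` need not be equivariant; the condition on kernels makes `g ∘ s` independent of
  -- it, and hence equivariant.
  choose s hs using hf
  have key : ∀ a, Nom.fn g (s (Nom.fn f a)) = Nom.fn g a := fun a => h _ _ (hs _)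
  refine ⟨Nom.mkHom (fun b => Nom.fn g (s b)) fun π b => ?_, key⟩
  rw [← Nom.fn_smul]
  refine h _ _ ?_
  rw [hs, Nom.fn_smul, hs]

theorem absMany_surjective {X : Nom V} : ∀ (n : ℕ) (c : (absPow V n).obj X),
    ∃ x a, c = absMany n x a
  | 0, c => ⟨Fin.elim0, c, rfl⟩
  | n + 1, c => by
    obtain ⟨x, d, rfl⟩ := absMk_surjective (X := (absPow V n).obj X) c
    obtain ⟨y, a, rfl⟩ := absMany_surjective n d
    exact ⟨Fin.cons x y, a, rfl⟩

variable [Infinite V]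

/-- If two renamings to one fresh name agree, so do the renamings to all fresh names. -/
theorem AbsRel.fresh {X : Nom V} {p q : V × X} (h : AbsRel X p q) {w : V} (hp : w ≠ p.1)
    (hq : w ≠ q.1) (hp' : w ∉ nsupp V p.2) (hq' : w ∉ nsupp V q.2) :
    transp p.1 w • p.2 = transp q.1 w • q.2 := by
  obtain ⟨z, hzp, hzq, hz, hz', e⟩ := h
  obtain ⟨A, hA, sA, zA⟩ := (notMem_nsupp_iff _ _).1 hz
  obtain ⟨B, hB, sB, zB⟩ := (notMem_nsupp_iff _ _).1 hz'
  obtain ⟨C, hC, sC, wC⟩ := (notMem_nsupp_iff _ _).1 hp'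
  obtain ⟨D, hD, sD, wD⟩ := (notMem_nsupp_iff _ _).1 hq'
  -- The old name `z` and the new name `w` are known to be fresh through different supporting sets.
  -- A third name `v` outside all of them allows passing from `z` to `v` and then from `v` to `w`.
  obtain ⟨v, hv⟩ :=
    ((((hA.union hB).union (hC.union hD)).insert p.1).insert q.1).exists_notMem
  simp only [Set.mem_insert_iff, Set.mem_union, not_or] at hv
  obtain ⟨vq, vp, ⟨vA, vB⟩, vC, vD⟩ := hv
  have e1 := congrArg (transp z v • ·) e
  simp only [transp_change sA zA vA vp, transp_change sB zB vB vq] at e1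
  have e2 := congrArg (transp v w • ·) e1
  simpa only [transp_change sC vC wC hp, transp_change sD vD wD hq] using e2

/-- Transitivity is where the witnesses differ: `AbsRel.fresh` moves both to one name that is fresh
for all three pairs. -/
theorem absRel_equivalence (X : Nom V) : Equivalence (AbsRel X) where
  refl p := by
    obtain ⟨A, hA, sA⟩ := exists_support p.2
    obtain ⟨z, hz⟩ := (hA.insert p.1).exists_notMem
    simp only [Set.mem_insert_iff, not_or] at hz
    exact ⟨z, hz.1, hz.1, notMem_nsupp_of_supports hA sA hz.2,
      notMem_nsupp_of_supports hA sA hz.2, rfl⟩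
  symm := by
    rintro p q ⟨z, h1, h2, h3, h4, h5⟩
    exact ⟨z, h2, h1, h4, h3, h5.symm⟩
  trans := by
    intro p q r h h'
    obtain ⟨A, hA, sA⟩ := exists_support p.2
    obtain ⟨B, hB, sB⟩ := exists_support q.2
    obtain ⟨C, hC, sC⟩ := exists_support r.2
    obtain ⟨v, hv⟩ :=
      (((((hA.union hB).union hC).insert p.1).insert q.1).insert r.1).exists_notMem
    simp only [Set.mem_insert_iff, Set.mem_union, not_or] at hv
    obtain ⟨vr, vq, vp, ⟨vA, vB⟩, vC⟩ := hv
    have fA := notMem_nsupp_of_supports hA sA vA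
    have fB := notMem_nsupp_of_supports hB sB vB
    have fC := notMem_nsupp_of_supports hC sC vC
    exact ⟨v, vp, vr, fA, fC, (h.fresh vp vq fA fB).trans (h'.fresh vq vr fB fC)⟩

theorem absMk_eq_iff {X : Nom V} {x y : V} {a b : X} :
    absMk x a = absMk y b ↔ AbsRel X (x, a) (y, b) :=
  Equivalence.quot_mk_eq_iff (absRel_equivalence X) _ _

/-- With the same name abstracted on both sides, the same transposition acts on both bodies and
cancels. -/
theorem absMk_injective {X : Nom V} (x : V) : Function.Injective (absMk (X := X) x) := by
  intro a b h
  obtain ⟨z, -, -, -, -, e⟩ := absMk_eq_iff.1 h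
  exact MulAction.injective _ e

/-- Renaming of an abstracted name to a fresh one. -/
theorem absMk_rename {X : Nom V} {A : Set V} {a : X} (hA : A.Finite)
    (h : MulAction.Supports (FinPerm V) A a) {x z : V} (hz : z ∉ A) :
    absMk x a = absMk z (transp x z • a) := by
  obtain ⟨B, hB, sB⟩ := exists_support (transp x z • a)
  obtain ⟨w, hw⟩ := (((hA.union hB).insert x).insert z).exists_notMem
  simp only [Set.mem_insert_iff, Set.mem_union, not_or] at hw
  obtain ⟨wz, wx, wA, wB⟩ := hw
  exact absMk_eq_iff.2 ⟨w, wx, wz, notMem_nsupp_of_supports hA h wA,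
    notMem_nsupp_of_supports hB sB wB, (transp_change h hz wA wx).symm⟩

/-- Concretion: an abstraction is of the form `⟨z⟩u` for each fresh `z`. -/
theorem exists_absMk_of_fresh {X : Nom V} {A : Set V} {c : X.abs} (hA : A.Finite)
    (h : MulAction.Supports (FinPerm V) A c) {z : V} (hz : z ∉ A) : ∃ a, c = absMk z a := by
  obtain ⟨x, a, rfl⟩ := absMk_surjective c
  obtain ⟨B, hB, sB⟩ := exists_support a
  obtain ⟨w, hw⟩ := ((hA.union hB).insert x).exists_notMem
  simp only [Set.mem_insert_iff, Set.mem_union, not_or] at hw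
  obtain ⟨wx, wA, wB⟩ := hw
  -- The name `z` is fresh for `c` but may occur in `a`, so `x` is first renamed to `w`, fresh for
  -- both. The transposition of `w` and `z` then fixes `c`, since both avoid `A`, and turns the
  -- binder `w` into `z`.
  refine ⟨transp w z • transp x w • a, ?_⟩
  have := h (transp w z) (fun v hv => transp_other (fun e => wA (e ▸ hv)) (fun e => hz (e ▸ hv)))
  rw [← this, absMk_rename hB sB wB, smul_absMk, transp_left]

/-- A permutation that fixes `x` and `A` fixes the abstraction with the same binder `x`, and
`absMk_injective` removes that binder. -/
theorem supports_of_absMk {X : Nom V} {A : Set V} {x : V} {a : X}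
    (h : MulAction.Supports (FinPerm V) A (absMk x a)) :
    MulAction.Supports (FinPerm V) (insert x A) a := by
  intro π hπ
  have := h π fun v hv => hπ (Or.inr hv)
  rw [smul_absMk, hπ (Or.inl rfl)] at this
  exact absMk_injective x this

/-- Both abstractions are opened at one name fresh for the two bodies. That name is still fresh for
their images, so the hypothesis can be read at it. -/
theorem absMap_injective {X Y : Nom V} (f : X ⟶ Y) (hf : Function.Injective (Nom.fn f)) :
    Function.Injective (Nom.fn (Nom.absMap f)) := by
  intro c d h
  obtain ⟨x, a, rfl⟩ := absMk_surjective c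
  obtain ⟨y, b, rfl⟩ := absMk_surjective d
  obtain ⟨A, hA, sA⟩ := exists_support a
  obtain ⟨B, hB, sB⟩ := exists_support b
  obtain ⟨z, hz⟩ := (((hA.union hB).insert x).insert y).exists_notMem
  simp only [Set.mem_insert_iff, Set.mem_union, not_or] at hz
  obtain ⟨zy, zx, zA, zB⟩ := hz
  have fA := notMem_nsupp_of_supports hA sA zA
  have fB := notMem_nsupp_of_supports hB sB zB
  have e := (absMk_eq_iff.1 (show absMk x (Nom.fn f a) = absMk y (Nom.fn f b) from h)).fresh
    zx zy (notMem_nsupp_fn f fA) (notMem_nsupp_fn f fB)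
  refine absMk_eq_iff.2 ⟨z, zx, zy, fA, fB, hf ?_⟩
  rw [Nom.fn_smul, Nom.fn_smul]
  exact e

theorem absPow_map_injective {X Y : Nom V} (f : X ⟶ Y) (hf : Function.Injective (Nom.fn f)) :
    ∀ n, Function.Injective (Nom.fn ((absPow V n).map f))
  | 0 => hf
  | n + 1 => absMap_injective _ (absPow_map_injective f hf n)

theorem absMany_injective {X : Nom V} : ∀ (n : ℕ) (x : Fin n → V),
    Function.Injective (absMany (X := X) n x)
  | 0, _ => fun _ _ h => h
  | n + 1, x => fun _ _ h => absMany_injective n (Fin.tail x) (absMk_injective (x 0) h)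

/-- Renaming of abstracted names to distinct fresh ones. -/
theorem absMany_rename {X : Nom V} {A : Set V} {a : X} (hA : A.Finite)
    (h : MulAction.Supports (FinPerm V) A a) : ∀ (n : ℕ) (x z : Fin n → V),
    Function.Injective z → (∀ j, z j ∉ A) → (∀ i j, z i ≠ x j) →
    absMany n x a = absMany n z (transpList x z • a)
  | 0, x, z, _, _, _ => by
    change a = transpList x z • a
    simp [transpList]
  | n + 1, x, z, hz, hzA, hzx => by
    have ih := absMany_rename hA h n (Fin.tail x) (Fin.tail z)
      (fun i j e => Fin.succ_injective _ (hz e)) (fun j => hzA _) (fun i j => hzx _ _)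
    change absMk (X := (absPow V n).obj X) (x 0) (absMany n (Fin.tail x) a) =
      absMk (X := (absPow V n).obj X) (z 0) (absMany n (Fin.tail z) (transpList x z • a))
    rw [absMk_rename ((Set.finite_range _).union hA) (supports_absMany h n (Fin.tail x)) (z := z 0)
      (by
        rintro (⟨j, hj⟩ | hj)
        · exact hzx _ _ hj.symm
        · exact hzA _ hj), ih, ← absMany_smul, ← mul_smul, ← transpList_succ]
    -- The outer transposition has also been applied to the inner binders; they differ from `x 0`
    -- and `z 0`, so it fixes them.
    congr 2
    funext j
    exact transp_other (hzx _ _) fun e => Fin.succ_ne_zero j (hz e)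

/-- Renaming both lists of binders to the same fresh list `z` reduces the question to injectivity of
abstraction along `z`. Since `z` is arbitrary among fresh lists, this matches both the existential
premise of `AlphaEq.op` and its use with a chosen list. -/
theorem absMany_eq_iff {X : Nom V} {A B : Set V} {a b : X} (hA : A.Finite) (hB : B.Finite)
    (sA : MulAction.Supports (FinPerm V) A a) (sB : MulAction.Supports (FinPerm V) B b) {n : ℕ}
    {x y z : Fin n → V} (hz : Function.Injective z) (zA : ∀ j, z j ∉ A) (zB : ∀ j, z j ∉ B)
    (zx : ∀ i j, z i ≠ x j) (zy : ∀ i j, z i ≠ y j) :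
    absMany n x a = absMany n y b ↔ transpList x z • a = transpList y z • b := by
  rw [absMany_rename hA sA n x z hz zA zx, absMany_rename hB sB n y z hz zB zy]
  exact (absMany_injective n z).eq_iff

end NominalFacts

/-! ### Limits of sequences of nominal sets -/

section SequentialLimits

variable {V : Type u}

/-- `L` with the projections `π` is the limit in nominal sets of the sequence `X`. -/
structure IsSeqLimit (X : ℕ → Nom V) (p : ∀ n, X (n + 1) ⟶ X n) (L : Nom V)
    (π : ∀ n, L ⟶ X n) : Prop where
  comp : ∀ n, π (n + 1) ≫ p n = π n
  ext : ∀ a b : L, (∀ n, Nom.fn (π n) a = Nom.fn (π n) b) → a = b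
  -- One finite `A` must serve all levels: this is what distinguishes the limit in nominal sets from
  -- the limit of the underlying sets.
  exists_lift : ∀ a : ∀ n, X n, (∀ n, Nom.fn (p n) (a (n + 1)) = a n) → ∀ A : Set V, A.Finite →
    (∀ n, MulAction.Supports (FinPerm V) A (a n)) → ∃ l, ∀ n, Nom.fn (π n) l = a n

/-- A functor that preserves limits of sequences. -/
def PreservesSeqLimits (G : Nom V ⥤ Nom V) : Prop :=
  ∀ (X : ℕ → Nom V) (p : ∀ n, X (n + 1) ⟶ X n) (L : Nom V) (π : ∀ n, L ⟶ X n),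
    IsSeqLimit X p L π →
      IsSeqLimit (fun n => G.obj (X n)) (fun n => G.map (p n)) (G.obj L) (fun n => G.map (π n))

/-- A name `z` outside the common support opens all members of a coherent sequence at once.
Injectivity of `⟨z⟩` makes the bodies coherent, and adding `z` to `A` gives them a common finite
support, so they lift. Points are separated by opening both at a common fresh name. -/
theorem preservesSeqLimits_absFunctor [Infinite V] : PreservesSeqLimits (absFunctor V) := by
  intro X p L π h
  refine ⟨fun n => by rw [← Functor.map_comp, h.comp], fun c d e => ?_, fun c hc A hA sA => ?_⟩
  · obtain ⟨x, a, rfl⟩ := absMk_surjective (X := L) c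
    obtain ⟨y, b, rfl⟩ := absMk_surjective (X := L) d
    obtain ⟨A, hA, sA⟩ := exists_support a
    obtain ⟨B, hB, sB⟩ := exists_support b
    obtain ⟨z, hz⟩ := (((hA.union hB).insert x).insert y).exists_notMem
    simp only [Set.mem_insert_iff, Set.mem_union, not_or] at hz
    obtain ⟨zy, zx, zA, zB⟩ := hz
    have fA := notMem_nsupp_of_supports hA sA zA
    have fB := notMem_nsupp_of_supports hB sB zB
    refine absMk_eq_iff.2 ⟨z, zx, zy, fA, fB, h.ext _ _ fun n => ?_⟩
    rw [Nom.fn_smul, Nom.fn_smul]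
    exact (absMk_eq_iff.1 (show absMk x (Nom.fn (π n) a) = absMk y (Nom.fn (π n) b) from
      e n)).fresh zx zy (notMem_nsupp_fn _ fA) (notMem_nsupp_fn _ fB)
  · obtain ⟨z, hz⟩ := hA.exists_notMem
    choose a ha using fun n => exists_absMk_of_fresh (X := X n) hA (sA n) hz
    obtain ⟨l, hl⟩ := h.exists_lift a (fun n => absMk_injective z (by
      rw [← ha n, ← hc n, ha (n + 1)]
      rfl)) (insert z A) (hA.insert z) (fun n => supports_of_absMk (ha n ▸ sA n))
    exact ⟨absMk z l, fun n => by rw [ha n, ← hl n]; rfl⟩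

theorem preservesSeqLimits_absPow [Infinite V] : ∀ n, PreservesSeqLimits (absPow V n)
  | 0 => fun _ _ _ _ h => h
  | n + 1 => fun _ _ _ _ h =>
    preservesSeqLimits_absFunctor _ _ _ _ (preservesSeqLimits_absPow n _ _ _ _ h)

namespace IsSeqLimit

variable {X : ℕ → Nom V} {p : ∀ n, X (n + 1) ⟶ X n} {L : Nom V} {π : ∀ n, L ⟶ X n}

theorem hom_ext (h : IsSeqLimit X p L π) {C : Nom V} {f g : C ⟶ L}
    (e : ∀ n, f ≫ π n = g ≫ π n) : f = g :=
  Nom.hom_ext fun a => h.ext _ _ fun n => by rw [← Nom.fn_comp, e, Nom.fn_comp]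

/-- A finite support of a point supports all its images, so the lift exists pointwise; joint
injectivity of the projections makes it equivariant. -/
theorem exists_hom (h : IsSeqLimit X p L π) {C : Nom V} (c : ∀ n, C ⟶ X n)
    (hc : ∀ n, c (n + 1) ≫ p n = c n) : ∃ f : C ⟶ L, ∀ n, f ≫ π n = c n := by
  have (a : C) : ∃ l, ∀ n, Nom.fn (π n) l = Nom.fn (c n) a := by
    obtain ⟨A, hA, sA⟩ := exists_support a
    exact h.exists_lift (fun n => Nom.fn (c n) a) (fun n => by rw [← Nom.fn_comp, hc]) A hA
      (fun n => Nom.supports_fn _ sA)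
  choose f hf using this
  refine ⟨Nom.mkHom f fun σ a => h.ext _ _ fun n => ?_, fun n => Nom.hom_ext fun a => hf a n⟩
  rw [hf, Nom.fn_smul, Nom.fn_smul, hf]

end IsSeqLimit

/-- The limit of a sequence of nominal sets: the finitely supported elements of the limit of the
underlying sets. -/
def Nom.seqLimit (X : ℕ → Nom V) (p : ∀ n, X (n + 1) ⟶ X n) : Nom V where
  carrier := {a : ∀ n, X n // (∀ n, Nom.fn (p n) (a (n + 1)) = a n) ∧
    ∃ A : Set V, A.Finite ∧ ∀ n, MulAction.Supports (FinPerm V) A (a n)}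
  act :=
    { smul := fun σ a => ⟨fun n => σ • a.1 n, fun n => by rw [Nom.fn_smul, a.2.1], by
        obtain ⟨A, hA, sA⟩ := a.2.2
        exact ⟨_, hA.image _, fun n => supports_smul (sA n) σ⟩⟩
      one_smul := fun a => Subtype.ext (funext fun n => one_smul _ _)
      mul_smul := fun σ τ a => Subtype.ext (funext fun n => mul_smul _ _ _) }
  finSupp a := by
    obtain ⟨A, hA, sA⟩ := a.2.2
    exact ⟨A, hA, fun σ hσ => Subtype.ext (funext fun n => sA n σ hσ)⟩

theorem Nom.isSeqLimit_seqLimit (X : ℕ → Nom V) (p : ∀ n, X (n + 1) ⟶ X n) :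
    IsSeqLimit X p (Nom.seqLimit X p)
      (fun n => Nom.mkHom (X := Nom.seqLimit X p) (fun a => a.1 n) fun _ _ => rfl) where
  comp n := Nom.hom_ext fun a => a.2.1 n
  ext _ _ h := Subtype.ext (funext h)
  exists_lift a ha A hA sA := ⟨⟨a, ha, A, hA, sA⟩, fun _ => rfl⟩

/-! ### Final coalgebras of functors that preserve limits of sequences -/

theorem coalgebra_hom_cone {G : Nom V ⥤ Nom V} {C D : Endofunctor.Coalgebra G} (f : C ⟶ D) :
    ∀ n, f.f ≫ cone D n = cone C n
  | 0 => rfl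
  | n + 1 => by
    change f.f ≫ D.str ≫ G.map (cone D n) = C.str ≫ G.map (cone C n)
    rw [← Category.assoc, ← f.h, Category.assoc, ← Functor.map_comp, coalgebra_hom_cone f n]

/-- A coalgebra that is the limit of the terminal sequence is final. -/
theorem nonempty_isTerminal_of_isSeqLimit {G : Nom V ⥤ Nom V} (hG : PreservesSeqLimits G)
    {C : Endofunctor.Coalgebra G} (h : IsSeqLimit (iter G) (iterProj G) C.V (cone C)) :
    Nonempty (IsTerminal C) := by
  have ex (D : Endofunctor.Coalgebra G) : Nonempty (D ⟶ C) := by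
    obtain ⟨f, hf⟩ := h.exists_hom (cone D) (cone_comp D)
    -- The coalgebra square is an equation of maps into `G C`. Preservation makes `G C` a limit of
    -- the shifted sequence, so the equation can be tested on projections.
    refine ⟨⟨f, (hG _ _ _ _ h).hom_ext fun n => ?_⟩⟩
    rw [Category.assoc, Category.assoc, ← Functor.map_comp, hf]
    exact (hf (n + 1)).symm
  refine ⟨IsTerminal.ofUniqueHom (fun D => (ex D).some) fun D f => Endofunctor.Coalgebra.Hom.ext
    (h.hom_ext fun n => ?_)⟩
  rw [coalgebra_hom_cone, coalgebra_hom_cone]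

/-- `G L` is a limit of the sequence shifted by one, so the projections `π (n + 1)` factor through a
map from `L` to `G L`. The cone of this coalgebra is `π` again, by induction. -/
theorem exists_coalgebra_isSeqLimit {G : Nom V ⥤ Nom V} (hG : PreservesSeqLimits G) :
    ∃ C : Endofunctor.Coalgebra G, IsSeqLimit (iter G) (iterProj G) C.V (cone C) := by
  obtain ⟨L, π, h⟩ : ∃ L π, IsSeqLimit (iter G) (iterProj G) L π :=
    ⟨_, _, Nom.isSeqLimit_seqLimit (iter G) (iterProj G)⟩
  obtain ⟨f, hf⟩ := (hG _ _ _ _ h).exists_hom (fun n => π (n + 1)) (fun n => h.comp (n + 1))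
  have e : ∀ n, cone (⟨L, f⟩ : Endofunctor.Coalgebra G) n = π n := by
    intro n
    induction n with
    | zero => rfl
    | succ n ih =>
      rw [← hf n, ← ih]
      rfl
  refine ⟨⟨L, f⟩, ?_⟩
  rwa [show cone (⟨L, f⟩ : Endofunctor.Coalgebra G) = π from funext e]

theorem hasTerminal_coalgebra {G : Nom V ⥤ Nom V} (hG : PreservesSeqLimits G) :
    HasTerminal (Endofunctor.Coalgebra G) := by
  obtain ⟨C, hC⟩ := exists_coalgebra_isSeqLimit hG
  exact (nonempty_isTerminal_of_isSeqLimit hG hC).some.hasTerminal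

/-- Final coalgebras are the limit of the terminal sequence. -/
theorem isSeqLimit_of_isTerminal {G : Nom V ⥤ Nom V} (hG : PreservesSeqLimits G)
    {T : Endofunctor.Coalgebra G} (hT : IsTerminal T) :
    IsSeqLimit (iter G) (iterProj G) T.V (cone T) := by
  obtain ⟨C, hC⟩ := exists_coalgebra_isSeqLimit hG
  obtain ⟨hC'⟩ := nonempty_isTerminal_of_isSeqLimit hG hC
  refine ⟨cone_comp T, fun a b h => ?_, fun a ha A hA sA => ?_⟩
  · have e : Nom.fn (hC'.from T).f a = Nom.fn (hC'.from T).f b := hC.ext _ _ fun n => by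
      rw [← Nom.fn_comp, coalgebra_hom_cone, h, ← coalgebra_hom_cone (hC'.from T), Nom.fn_comp]
    have k : (hC'.from T).f ≫ (hT.from C).f = 𝟙 _ :=
      congrArg Endofunctor.Coalgebra.Hom.f (hT.hom_ext (hC'.from T ≫ hT.from C) (𝟙 T))
    have := congrArg (Nom.fn (hT.from C).f) e
    rwa [← Nom.fn_comp, ← Nom.fn_comp, k] at this
  · obtain ⟨l, hl⟩ := hC.exists_lift a ha A hA sA
    refine ⟨Nom.fn (hT.from C).f l, fun n => ?_⟩
    rw [← Nom.fn_comp, coalgebra_hom_cone, hl]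

end SequentialLimits

/-! ### The functors of a signature preserve limits of sequences -/

section Shapes

variable {S : BindingSignature.{u}} {V : Type u}

theorem inr_sigma_inj {A ι : Type u} {B : ι → Type u} {f : ι} {p q : B f}
    (h : (Sum.inr ⟨f, p⟩ : A ⊕ Σ f, B f) = Sum.inr ⟨f, q⟩) : p = q := by
  cases h
  rfl

/-- The members of a coherent sequence have the same head symbol. -/
theorem coherent_shape {Y : ℕ → ∀ f : S.Op, Fin (S.numArgs f) → Type u}
    {q : ∀ n f i, Y (n + 1) f i → Y n f i} {a : ∀ n, V ⊕ (Σ f, ∀ i, Y n f i)}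
    (h : ∀ n, Sum.map id (Sigma.map id fun f p i => q n f i (p i)) (a (n + 1)) = a n) :
    (∃ x, ∀ n, a n = Sum.inl x) ∨
      ∃ f, ∃ p : ∀ n i, Y n f i, (∀ n, a n = Sum.inr ⟨f, p n⟩) ∧
        ∀ n i, q n f i (p (n + 1) i) = p n i := by
  rcases h0 : a 0 with x | ⟨f, p⟩
  · refine Or.inl ⟨x, fun n => ?_⟩
    induction n with
    | zero => exact h0
    | succ n ih =>
      have := h n
      rcases e : a (n + 1) with y | ⟨g, r⟩
      · rw [e, ih] at this
        exact congrArg Sum.inl (Sum.inl_injective this)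
      · rw [e, ih] at this
        cases this
  · have (n : ℕ) : ∃ p, a n = Sum.inr ⟨f, p⟩ := by
      induction n with
      | zero => exact ⟨p, h0⟩
      | succ n ih =>
        obtain ⟨p, ih⟩ := ih
        have := h n
        rcases e : a (n + 1) with y | ⟨g, r⟩
        · rw [e, ih] at this
          cases this
        · rw [e, ih] at this
          injection this with this
          injection this with this
          change g = f at this
          subst this
          exact ⟨r, rfl⟩
    choose p hp using this
    refine Or.inr ⟨f, p, hp, fun n i => ?_⟩
    have := h n
    rw [hp, hp] at this
    exact congrFun (inr_sigma_inj (B := fun f => ∀ i, Y n f i) this) i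

variable (S V)

/-- Coherence forces the same head symbol at all levels (`coherent_shape`), so the question reduces
to each argument, where it is the one for iterated abstraction. -/
theorem preservesSeqLimits_alphaFunctor [Infinite V] :
    PreservesSeqLimits (S.alphaFunctor V) := by
  intro X p L π h
  have hP (f : S.Op) (i : Fin (S.numArgs f)) :=
    preservesSeqLimits_absPow (S.numBind f i) X p L π h
  refine ⟨fun n => by rw [← Functor.map_comp, h.comp], fun c d e => ?_, fun c hc A hA sA => ?_⟩
  · rcases c with x | ⟨f, c⟩ <;> rcases d with y | ⟨g, d⟩
    · exact congrArg Sum.inl (Sum.inl_injective (e 0))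
    · cases e 0
    · cases e 0
    · have hfg : f = g := congrArg Sigma.fst (Sum.inr_injective (e 0))
      subst hfg
      exact inr_sigma_congr f (funext fun i => (hP f i).ext _ _ fun n =>
        congrFun (inr_sigma_inj (e n)) i)
  · rcases coherent_shape hc with ⟨x, hx⟩ | ⟨f, c', hc', e⟩
    · exact ⟨(Sum.inl x : V ⊕ _), fun n => (hx n).symm⟩
    · choose l hl using fun i => (hP f i).exists_lift (fun n => c' n i) (fun n => e n i) A hA
        (fun n σ hσ => by
          have := sA n σ hσ
          rw [hc' n] at this
          exact congrFun (inr_sigma_inj (f := f) (p := σ • c' n) (q := c' n)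
            (B := fun f => ∀ i, (absPow V (S.numBind f i)).obj (X n)) this) i)
      refine ⟨(Sum.inr ⟨f, l⟩ : V ⊕ (Σ f : S.Op, ∀ i : Fin (S.numArgs f),
        (absPow V (S.numBind f i)).obj L)), fun n => ?_⟩
      rw [hc' n]
      exact inr_sigma_congr f (funext fun i => hl i n)

theorem preservesSeqLimits_rawFunctor : PreservesSeqLimits (S.rawFunctor V) := by
  intro X p L π h
  refine ⟨fun n => by rw [← Functor.map_comp, h.comp], fun c d e => ?_, fun c hc A hA sA => ?_⟩
  · rcases c with x | ⟨f, c⟩ <;> rcases d with y | ⟨g, d⟩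
    · exact congrArg Sum.inl (Sum.inl_injective (e 0))
    · cases e 0
    · cases e 0
    · have hfg : f = g := congrArg Sigma.fst (Sum.inr_injective (e 0))
      subst hfg
      have e' (n : ℕ) (i : Fin (S.numArgs f)) :
          ((c i).1, Nom.fn (π n) (c i).2) = ((d i).1, Nom.fn (π n) (d i).2) :=
        congrFun (inr_sigma_inj (e n)) i
      exact inr_sigma_congr f (funext fun i => Prod.ext (Prod.mk.inj (e' 0 i)).1
        (h.ext _ _ fun n => (Prod.mk.inj (e' n i)).2))
  · rcases coherent_shape (S := S) (V := V)
      (Y := fun n f i => (Fin (S.numBind f i) → V) × X n) (a := c)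
      (q := fun n _ _ c => (c.1, Nom.fn (p n) c.2)) hc with
      ⟨x, hx⟩ | ⟨f, c', hc', e⟩
    · exact ⟨(Sum.inl x : V ⊕ _), fun n => (hx n).symm⟩
    · choose l hl using fun i => h.exists_lift (fun n => (c' n i).2)
        (fun n => congrArg Prod.snd (e n i)) A hA
        (fun n σ hσ => by
          have := sA n σ hσ
          rw [hc' n] at this
          exact congrArg Prod.snd (congrFun (inr_sigma_inj (f := f) (p := σ • c' n)
            (q := c' n) (B := fun f => ∀ i, (Fin (S.numBind f i) → V) × X n) this) i))
      -- The connecting maps do not touch the lists of binders, so the lists are constant along the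
      -- sequence and those at level 0 serve for the lift.
      have hx (i) (n : ℕ) : (c' n i).1 = (c' 0 i).1 := by
        induction n with
        | zero => rfl
        | succ n ih => exact (congrArg Prod.fst (e n i)).trans ih
      refine ⟨(Sum.inr ⟨f, fun i => ((c' 0 i).1, l i)⟩ : V ⊕ (Σ f : S.Op,
        ∀ i : Fin (S.numArgs f), (Fin (S.numBind f i) → V) × L)), fun n => ?_⟩
      rw [hc' n]
      exact inr_sigma_congr f (funext fun i => Prod.ext (hx i n).symm (hl i n))

end Shapes

/-! ### Infinitary raw terms as the limit of the terminal sequence -/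

section InfTerms

variable {S : BindingSignature.{u}} {V : Type u}

/-- Corecursion for infinitary raw terms. -/
theorem InfTerm.exists_unfold {C : Type u}
    (d : C → V ⊕ (Σ f : S.Op, ∀ i : Fin (S.numArgs f), (Fin (S.numBind f i) → V) × C)) :
    ∃ u : C → InfTerm S V, (∀ c x, d c = Sum.inl x → u c = InfTerm.var x) ∧
      ∀ c f p, d c = Sum.inr ⟨f, p⟩ →
        u c = InfTerm.op f (fun i => (p i).1) (fun i => u (p i).2) := by
  let g : V ⊕ (Σ f : S.Op, ∀ i : Fin (S.numArgs f), (Fin (S.numBind f i) → V) × C) →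
      (termPFunctor S V) C
    | Sum.inl x => ⟨Sum.inl x, fun e : Empty => e.elim⟩
    | Sum.inr ⟨f, p⟩ => ⟨Sum.inr ⟨f, fun i => (p i).1⟩, fun i : Fin (S.numArgs f) => (p i).2⟩
  have key (c : C) := PFunctor.M.dest_corec (fun c => g (d c)) c
  refine ⟨PFunctor.M.corec fun c => g (d c), fun c x h => ?_, fun c f p h => ?_⟩
  · rw [← PFunctor.M.mk_dest (PFunctor.M.corec _ c), key, h]
    exact congrArg (fun c : Empty → (termPFunctor S V).M =>
      PFunctor.M.mk (F := termPFunctor S V) ⟨Sum.inl x, c⟩) (funext fun e : Empty => e.elim)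
  · rw [← PFunctor.M.mk_dest (PFunctor.M.corec _ c), key, h]
    rfl

/-- The projection of an infinitary raw term to the terminal sequence. -/
def InfTerm.proj : (n : ℕ) → InfTerm S V → iter (S.rawFunctor V) n
  | 0, _ => PUnit.unit
  | n + 1, t =>
    match PFunctor.M.dest t with
    | ⟨Sum.inl x, _⟩ => (Sum.inl x : V ⊕ (Σ f : S.Op, ∀ i : Fin (S.numArgs f),
        (Fin (S.numBind f i) → V) × iter (S.rawFunctor V) n))
    | ⟨Sum.inr ⟨f, x⟩, c⟩ => (Sum.inr ⟨f, fun i => (x i, proj n (c i))⟩ : V ⊕ (Σ f : S.Op,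
        ∀ i : Fin (S.numArgs f), (Fin (S.numBind f i) → V) × iter (S.rawFunctor V) n))

theorem InfTerm.iterProj_proj (n : ℕ) (t : InfTerm S V) :
    Nom.fn (iterProj (S.rawFunctor V) n) (t.proj (n + 1)) = t.proj n := by
  induction n generalizing t with
  | zero => rfl
  | succ n ih =>
    rcases t.var_or_op with ⟨x, rfl⟩ | ⟨f, x, c, rfl⟩
    · rfl
    · exact inr_sigma_congr f (funext fun i => congrArg (Prod.mk (x i)) (ih (c i)))

/-- Having equal projections is a bisimulation: level 1 determines the head symbol, and level `n +
1` gives the equality of the arguments at level `n`. -/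
theorem InfTerm.ext_proj {t s : InfTerm S V} (h : ∀ n, t.proj n = s.proj n) : t = s := by
  refine PFunctor.M.bisim (fun t s : InfTerm S V => ∀ n, t.proj n = s.proj n)
    (fun t s h => ?_) t s h
  rcases InfTerm.var_or_op t with ⟨x, rfl⟩ | ⟨f, x, c, rfl⟩ <;>
    rcases InfTerm.var_or_op s with ⟨y, rfl⟩ | ⟨g, y, d, rfl⟩
  · obtain rfl : x = y := Sum.inl_injective (h 1)
    exact ⟨_, _, _, rfl, rfl, fun e : Empty => e.elim⟩
  · cases h 1
  · cases h 1
  · have hfg : f = g := congrArg Sigma.fst (Sum.inr_injective (h 1))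
    subst hfg
    have h' (n : ℕ) (i : Fin (S.numArgs f)) : (x i, (c i).proj n) = (y i, (d i).proj n) :=
      congrFun (inr_sigma_inj (h (n + 1))) i
    obtain rfl : x = y := funext fun i => congrArg Prod.fst (h' 0 i)
    exact ⟨_, _, _, rfl, rfl, fun (i : Fin (S.numArgs f)) n => congrArg Prod.snd (h' n i)⟩

/-- The set of all coherent sequences is itself a coalgebra: the head symbol is constant and the
arguments are coherent again. Unfolding it gives the term, and no finiteness of support is needed.
-/
theorem InfTerm.exists_proj_eq (a : LimU (S.rawFunctor V)) :
    ∃ t : InfTerm S V, ∀ n, t.proj n = a.1 n := by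
  -- The index is shifted by one because level 0 is the terminal object, which carries no head
  -- symbol.
  have shape (a : LimU (S.rawFunctor V)) := coherent_shape (S := S) (V := V)
    (Y := fun n f i => (Fin (S.numBind f i) → V) × iter (S.rawFunctor V) n)
    (a := fun n => a.1 (n + 1)) (q := fun n _ _ c => (c.1, Nom.fn (iterProj (S.rawFunctor V) n) c.2)) (fun n => a.2 (n + 1))
  have (a : LimU (S.rawFunctor V)) : ∃ d : V ⊕ (Σ f : S.Op, ∀ i : Fin (S.numArgs f),
      (Fin (S.numBind f i) → V) × LimU (S.rawFunctor V)), ∀ n, a.1 (n + 1) =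
        Sum.map id (Sigma.map id fun f p i => ((p i).1, (p i).2.1 n)) d := by
    rcases shape a with ⟨x, hx⟩ | ⟨f, p, hp, e⟩
    · exact ⟨Sum.inl x, hx⟩
    · have hx (i) (n : ℕ) : (p n i).1 = (p 0 i).1 := by
        induction n with
        | zero => rfl
        | succ n ih => exact (congrArg Prod.fst (e n i)).trans ih
      refine ⟨Sum.inr ⟨f, fun i => ((p 0 i).1, ⟨fun n => (p n i).2,
        fun n => congrArg Prod.snd (e n i)⟩)⟩, fun n => ?_⟩
      rw [hp n]
      exact inr_sigma_congr f (funext fun i => Prod.ext (hx i n) rfl)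
  choose d hd using this
  obtain ⟨u, hv, ho⟩ := InfTerm.exists_unfold d
  refine ⟨u a, fun n => ?_⟩
  induction n generalizing a with
  | zero => rfl
  | succ n ih =>
    rw [hd a n]
    rcases e : d a with x | ⟨f, p⟩
    · rw [hv a x e]
      rfl
    · rw [ho a f p e]
      exact inr_sigma_congr f (funext fun i => congrArg (Prod.mk _) (ih (p i).2))

/-- The set of infinitary raw terms is the limit of the terminal sequence of `F`. -/
def InfTerm.equivLim : InfTerm S V ≃ LimU (S.rawFunctor V) :=
  Equiv.ofBijective (fun t => ⟨fun n => t.proj n, fun n => t.iterProj_proj n⟩)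
    ⟨fun _ _ h => InfTerm.ext_proj fun n => congrFun (congrArg Subtype.val h) n,
      fun a => (InfTerm.exists_proj_eq a).imp fun _ h => Subtype.ext (funext h)⟩

/-- The raw term, with `*` at depth `n`, of an element of the terminal sequence. -/
def iterToRaw : (n : ℕ) → iter (S.rawFunctor V) n → RawTerm S.withStar V
  | 0, _ => star S V
  | n + 1, a => Sum.elim (β := Σ f : S.Op, ∀ i : Fin (S.numArgs f),
      (Fin (S.numBind f i) → V) × iter (S.rawFunctor V) n) RawTerm.var
      (fun p => RawTerm.op (S := S.withStar) (some p.1) (fun i => (p.2 i).1)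
        (fun i => iterToRaw n (p.2 i).2)) a

theorem iterToRaw_proj (n : ℕ) (t : InfTerm S V) : iterToRaw n (t.proj n) = t.trunc n := by
  induction n generalizing t with
  | zero => rfl
  | succ n ih =>
    rcases t.var_or_op with ⟨x, rfl⟩ | ⟨f, x, c, rfl⟩
    · rfl
    · exact congrArg (RawTerm.op (S := S.withStar) (some f) x) (funext fun i => ih (c i))

theorem iterToRaw_injective : ∀ n, Function.Injective (iterToRaw (S := S) (V := V) n)
  | 0 => fun _ _ _ => rfl
  | n + 1 => by
    rintro (x | ⟨f, p⟩) (y | ⟨g, r⟩) h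
    · exact congrArg Sum.inl (RawTerm.var.inj h)
    · cases h
    · cases h
    · have h' : RawTerm.op (S := S.withStar) (some f) (fun i => (p i).1)
        (fun i => iterToRaw n (p i).2) = RawTerm.op (S := S.withStar) (some g)
          (fun i => (r i).1) (fun i => iterToRaw n (r i).2) := h
      injection h' with h1 h2 h3
      injection h1 with h1
      subst h1
      exact inr_sigma_congr f (funext fun i => Prod.ext (congrFun (eq_of_heq h2) i)
        (iterToRaw_injective n (congrFun (eq_of_heq h3) i)))

theorem InfTerm.proj_eq_iff {n : ℕ} {t s : InfTerm S V} :
    t.proj n = s.proj n ↔ t.trunc n = s.trunc n := by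
  rw [← iterToRaw_proj, ← iterToRaw_proj, (iterToRaw_injective n).eq_iff]

theorem InfTerm.ext_trunc {t s : InfTerm S V} (h : ∀ n, t.trunc n = s.trunc n) : t = s :=
  InfTerm.ext_proj fun n => InfTerm.proj_eq_iff.2 (h n)

theorem InfTerm.tendsto_iff {s : ℕ → InfTerm S V} {t : InfTerm S V} :
    Tendsto s atTop (𝓝 t) ↔ ∀ n, ∀ᶠ k in atTop, (s k).trunc n = t.trunc n := by
  rw [Metric.tendsto_nhds]
  refine ⟨fun h n => (h ((1 / 2 : ℝ) ^ n) (by positivity)).mono fun k hk => ?_,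
    fun h ε hε => ?_⟩
  · exact rel_of_depthDist_lt (fun n t s => InfTerm.trunc n t = InfTerm.trunc n s)
      (fun _ _ => rfl) InfTerm.trunc_succ_eq hk
  · obtain ⟨n, hn⟩ := exists_pow_lt_of_lt_one hε (by norm_num : (1 / 2 : ℝ) < 1)
    exact (h n).mono fun k hk => lt_of_le_of_lt
      (depthDist_le (fun n t s => InfTerm.trunc n t = InfTerm.trunc n s) hk) hn

/-- At each depth the truncations become constant, and the constant values form a coherent sequence,
hence a term. -/
theorem InfTerm.exists_tendsto_of_cauchySeq {s : ℕ → InfTerm S V} (h : CauchySeq s) :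
    ∃ t, Tendsto s atTop (𝓝 t) := by
  have (n : ℕ) : ∃ N, ∀ k ≥ N, (s k).trunc n = (s N).trunc n := by
    obtain ⟨N, hN⟩ := Metric.cauchySeq_iff'.1 h ((1 / 2 : ℝ) ^ n) (by positivity)
    exact ⟨N, fun k hk => rel_of_depthDist_lt
      (fun n t s => InfTerm.trunc n t = InfTerm.trunc n s)
      (fun _ _ => rfl) InfTerm.trunc_succ_eq (hN k hk)⟩
  choose N hN using this
  obtain ⟨t, ht⟩ := InfTerm.exists_proj_eq (S := S) (V := V)
    ⟨fun n => (s (N n)).proj n, fun n => by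
      -- The indices `N n` need not increase with `n`, so levels `n` and `n + 1` are compared at an
      -- index beyond both.
      have e1 := hN n (max (N n) (N (n + 1))) (le_max_left _ _)
      have e2 := hN (n + 1) (max (N n) (N (n + 1))) (le_max_right _ _)
      rw [← InfTerm.proj_eq_iff] at e1 e2
      beta_reduce
      rw [← e2, ← e1, InfTerm.iterProj_proj]⟩
  refine ⟨t, InfTerm.tendsto_iff.2 fun n => (eventually_ge_atTop (N n)).mono fun k hk => ?_⟩
  rw [hN n k hk, ← InfTerm.proj_eq_iff, ht]

/-- Each truncation of the limit is already a truncation of some member of the sequence, so the free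
names of the limit lie in the given finite union. -/
theorem InfTerm.fv_finite_of_tendsto {s : ℕ → RawTerm S V} {t : InfTerm S V}
    (hs : (⋃ k, (s k).fv).Finite) (h : Tendsto (fun k => (s k).toInf) atTop (𝓝 t)) :
    t.fv.Finite := by
  refine hs.subset (Set.iUnion_subset fun n => ?_)
  obtain ⟨k, hk⟩ := (InfTerm.tendsto_iff.1 h n).exists
  rw [← hk, RawTerm.trunc_toInf]
  exact (RawTerm.fv_trunc_subset n (s k)).trans (Set.subset_iUnion (fun k => (s k).fv) k)

theorem InfTerm.tendsto_approx_toInf [Infinite V] (t : InfTerm S V) :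
    Tendsto (fun k => (t.approx k).toInf) atTop (𝓝 t) :=
  InfTerm.tendsto_iff.2 fun n => (eventually_ge_atTop n).mono fun k hk => by
    rw [RawTerm.trunc_toInf, InfTerm.trunc_approx_of_le hk]

/-- The infinitary raw terms with finitely many free names are the limits of sequences of finite
raw terms with finitely many free names in total. -/
theorem InfTerm.fv_finite_iff [Infinite V] (t : InfTerm S V) : t.fv.Finite ↔
    ∃ s : ℕ → RawTerm S V, (⋃ k, (s k).fv).Finite ∧
      Tendsto (fun k => (s k).toInf) atTop (𝓝 t) := by
  refine ⟨fun h => ⟨fun k => t.approx k, ?_, t.tendsto_approx_toInf⟩,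
    fun ⟨s, hs, h⟩ => InfTerm.fv_finite_of_tendsto hs h⟩
  -- The approximants put one fixed name in place of `*`, which adds at most that name to the free
  -- names of `t`.
  refine (h.union (Set.finite_singleton (Classical.arbitrary V))).subset
    (Set.iUnion_subset fun k => (InfTerm.fv_approx_subset k t).trans ?_)
  exact Set.union_subset_union_left _ (Set.subset_iUnion (fun n => (t.trunc n).fv) k)

theorem InfTerm.existsUnique_limit {s : ℕ → RawTerm S V} (hs : (⋃ k, (s k).fv).Finite)
    (h : CauchySeq fun k => (s k).toInf) :
    ∃! t : InfTerm S V, t.fv.Finite ∧ Tendsto (fun k => (s k).toInf) atTop (𝓝 t) := by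
  obtain ⟨t, ht⟩ := InfTerm.exists_tendsto_of_cauchySeq h
  refine ⟨t, ⟨InfTerm.fv_finite_of_tendsto hs ht, ht⟩, fun t' ht' => InfTerm.ext_trunc fun n => ?_⟩
  obtain ⟨k, h1, h2⟩ := ((InfTerm.tendsto_iff.1 ht n).and (InfTerm.tendsto_iff.1 ht'.2 n)).exists
  rw [← h1, ← h2]

end InfTerms

/-! ### Initial algebras -/

section InitialAlgebras

variable (S : BindingSignature.{u}) (V : Type u)

theorem RawTerm.supports_vars {S : BindingSignature.{u}} {V : Type u} (t : RawTerm S V) :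
    MulAction.Supports (FinPerm V) t.vars t := fun π hπ => by
  have := RawTerm.smul_congr π 1 t fun v hv => by rw [hπ hv, one_smul]
  rwa [one_smul] at this

/-- The nominal set of finite raw terms. -/
abbrev rawTermNom : Nom V where
  carrier := RawTerm S V
  finSupp t := ⟨t.vars, t.vars_finite, t.supports_vars⟩

/-- The algebra of finite raw terms. -/
def rawTermAlgebra : Endofunctor.Algebra (S.rawFunctor V) where
  a := rawTermNom S V
  str := Nom.mkHom (X := S.rawObj V (rawTermNom S V)) (Y := rawTermNom S V)
    (Sum.elim (β := Σ f : S.Op, ∀ i : Fin (S.numArgs f),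
      (Fin (S.numBind f i) → V) × RawTerm S V) RawTerm.var
      (fun p => RawTerm.op p.1 (fun i => (p.2 i).1) (fun i => (p.2 i).2))) (by
    rintro π (x | ⟨f, p⟩) <;> rfl)

variable {S V}

/-- The element `x` of `F X`. -/
def rawVar (X : Nom V) (x : V) : (S.rawFunctor V).obj X :=
  (Sum.inl x : V ⊕ (Σ f : S.Op, ∀ i : Fin (S.numArgs f), (Fin (S.numBind f i) → V) × X))

/-- The element `op (xᵢ, aᵢ)ᵢ` of `F X`. -/
def rawOp {X : Nom V} (f : S.Op) (x : ∀ i : Fin (S.numArgs f), Fin (S.numBind f i) → V)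
    (a : Fin (S.numArgs f) → X) : (S.rawFunctor V).obj X :=
  (Sum.inr ⟨f, fun i => (x i, a i)⟩ :
    V ⊕ (Σ f : S.Op, ∀ i : Fin (S.numArgs f), (Fin (S.numBind f i) → V) × X))

/-- The element `x` of `F_α X`. -/
def alphaVar (X : Nom V) (x : V) : (S.alphaFunctor V).obj X :=
  (Sum.inl x : V ⊕ (Σ f : S.Op, ∀ i : Fin (S.numArgs f), (absPow V (S.numBind f i)).obj X))

/-- The element `op (⟨xᵢ⟩aᵢ)ᵢ` of `F_α X`. -/
def alphaOp {X : Nom V} (f : S.Op) (x : ∀ i : Fin (S.numArgs f), Fin (S.numBind f i) → V)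
    (a : Fin (S.numArgs f) → X) : (S.alphaFunctor V).obj X :=
  (Sum.inr ⟨f, fun i => absMany (S.numBind f i) (x i) (a i)⟩ :
    V ⊕ (Σ f : S.Op, ∀ i : Fin (S.numArgs f), (absPow V (S.numBind f i)).obj X))

theorem raw_cases {X : Nom V} (c : (S.rawFunctor V).obj X) :
    (∃ x, c = rawVar X x) ∨ ∃ f x a, c = rawOp f x a := by
  rcases c with x | ⟨f, p⟩
  · exact Or.inl ⟨x, rfl⟩
  · exact Or.inr ⟨f, fun i => (p i).1, fun i => (p i).2, rfl⟩

theorem alpha_cases {X : Nom V} (c : (S.alphaFunctor V).obj X) :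
    (∃ x, c = alphaVar X x) ∨ ∃ f x a, c = alphaOp f x a := by
  rcases c with x | ⟨f, p⟩
  · exact Or.inl ⟨x, rfl⟩
  · choose x a h using fun i => absMany_surjective _ (p i)
    exact Or.inr ⟨f, x, a, inr_sigma_congr f (funext h)⟩

theorem alphaMap_op {X Y : Nom V} (g : X ⟶ Y) (f : S.Op)
    (x : ∀ i : Fin (S.numArgs f), Fin (S.numBind f i) → V) (a : Fin (S.numArgs f) → X) :
    Nom.fn ((S.alphaFunctor V).map g) (alphaOp f x a) = alphaOp f x fun i => Nom.fn g (a i) :=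
  inr_sigma_congr f (funext fun i => absMany_map g _ (x i) (a i))

theorem alphaOp_eq_iff {X : Nom V} {f : S.Op}
    {x y : ∀ i : Fin (S.numArgs f), Fin (S.numBind f i) → V} {a b : Fin (S.numArgs f) → X} :
    alphaOp f x a = alphaOp f y b ↔
      ∀ i, absMany (S.numBind f i) (x i) (a i) = absMany (S.numBind f i) (y i) (b i) :=
  ⟨fun h i => congrFun (inr_sigma_inj (f := f)
    (B := fun f => ∀ i : Fin (S.numArgs f), (absPow V (S.numBind f i)).obj X) h) i,
    fun h => inr_sigma_congr f (funext h)⟩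

theorem alphaMap_surjective {X Y : Nom V} (g : X ⟶ Y) (hg : Function.Surjective (Nom.fn g)) :
    Function.Surjective (Nom.fn ((S.alphaFunctor V).map g)) := by
  intro c
  rcases alpha_cases c with ⟨x, rfl⟩ | ⟨f, x, b, rfl⟩
  · exact ⟨alphaVar X x, rfl⟩
  · choose a ha using fun i => hg (b i)
    exact ⟨alphaOp f x a, by rw [alphaMap_op]; simp only [ha]⟩

theorem quot_surjective (X : Nom V) : Function.Surjective (Nom.fn ((S.quot V).app X)) := by
  intro c
  rcases alpha_cases c with ⟨x, rfl⟩ | ⟨f, x, a, rfl⟩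
  · exact ⟨rawVar X x, rfl⟩
  · exact ⟨rawOp f x a, rfl⟩

theorem alphaMap_injective [Infinite V] {X Y : Nom V} (g : X ⟶ Y)
    (hg : Function.Injective (Nom.fn g)) :
    Function.Injective (Nom.fn ((S.alphaFunctor V).map g)) := by
  rintro (x | ⟨f, c⟩) (y | ⟨k, d⟩) e
  · exact congrArg Sum.inl (Sum.inl_injective e)
  · cases e
  · cases e
  · have hfk : f = k := congrArg Sigma.fst (Sum.inr_injective e)
    subst hfk
    exact inr_sigma_congr f (funext fun i => absPow_map_injective g hg _
      (congrFun (inr_sigma_inj e) i))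

/-- Evaluation of finite raw terms in an algebra. -/
def RawTerm.fold (A : Endofunctor.Algebra (S.rawFunctor V)) : RawTerm S V → A.a
  | var x => Nom.fn A.str (rawVar A.a x)
  | op f x t => Nom.fn A.str (rawOp f x fun i => fold A (t i))

theorem RawTerm.fold_smul (A : Endofunctor.Algebra (S.rawFunctor V)) (π : FinPerm V)
    (t : RawTerm S V) : (π • t).fold A = π • t.fold A := by
  induction t with
  | var x => exact Nom.fn_smul A.str π (rawVar A.a x)
  | op f x t ih =>
    rw [RawTerm.smul_op, RawTerm.fold, RawTerm.fold, ← Nom.fn_smul]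
    simp only [ih]
    rfl

theorem nonempty_isInitial_rawTermAlgebra : Nonempty (IsInitial (rawTermAlgebra S V)) := by
  refine ⟨IsInitial.ofUniqueHom (fun A => ⟨Nom.mkHom (X := rawTermNom S V)
    (RawTerm.fold A) (RawTerm.fold_smul A), ?_⟩) fun A h => Endofunctor.Algebra.Hom.ext ?_⟩
  · refine Nom.hom_ext fun c => ?_
    rcases raw_cases c with ⟨x, rfl⟩ | ⟨f, x, a, rfl⟩ <;> rfl
  · refine Nom.hom_ext fun t => ?_
    have key (c) : Nom.fn A.str (Nom.fn ((S.rawFunctor V).map h.f) c) =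
      Nom.fn h.f (Nom.fn (rawTermAlgebra S V).str c) := congrArg (fun k => Nom.fn k c) h.h
    change RawTerm S V at t
    change Nom.fn h.f t = t.fold A
    induction t with
    | var x => exact (key (rawVar _ x)).symm
    | op f x t ih =>
      refine (key (rawOp (X := rawTermNom S V) f x t)).symm.trans (congrArg (Nom.fn A.str) ?_)
      exact inr_sigma_congr f (funext fun i => congrArg (Prod.mk (x i)) (ih i))

variable [Infinite V]

variable (S V) in
/-- The nominal set of α-equivalence classes of finite raw terms. -/
abbrev termClassNom : Nom V where
  carrier := TermClass S V
  finSupp := by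
    rintro ⟨t⟩
    exact ⟨t.fv, t.fv_finite, TermClass.supports_mk t⟩

variable (S V) in
/-- The projection of raw terms to their α-equivalence classes. -/
def termClassMk : rawTermNom S V ⟶ termClassNom S V :=
  Nom.mkHom (X := rawTermNom S V) (Y := termClassNom S V) TermClass.mk fun _ _ => rfl

theorem TermClass.mk_surjective : Function.Surjective (TermClass.mk (S := S) (V := V)) :=
  Quotient.mk_surjective

/-- By `absMany_eq_iff` equality of the abstractions can be read at any fresh list of binders: at
the one given by the rule in one direction, at a newly chosen one in the other. The names of a raw
term support its class, so freshness for the term suffices. -/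
theorem alphaEq_op_iff {f : S.Op} {x y : ∀ i : Fin (S.numArgs f), Fin (S.numBind f i) → V}
    {t s : Fin (S.numArgs f) → RawTerm S V} :
    AlphaEq (RawTerm.op f x t) (RawTerm.op f y s) ↔
      alphaOp (X := termClassNom S V) f x (fun i => TermClass.mk (t i)) =
        alphaOp f y (fun i => TermClass.mk (s i)) := by
  refine Iff.trans ?_ alphaOp_eq_iff.symm
  have key (z : ∀ i : Fin (S.numArgs f), Fin (S.numBind f i) → V)
      (hz : ∀ i, Function.Injective (z i))
      (hf : ∀ i j, z i j ∉ (RawTerm.op f x t).vars ∧ z i j ∉ (RawTerm.op f y s).vars)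
      (i : Fin (S.numArgs f)) :
      absMany (X := termClassNom S V) (S.numBind f i) (x i) (TermClass.mk (t i)) =
        absMany (S.numBind f i) (y i) (TermClass.mk (s i)) ↔
      AlphaEq (transpList (x i) (z i) • t i) (transpList (y i) (z i) • s i) := by
    have h1 := fun j => notMem_vars_op (hf i j).1 i
    have h2 := fun j => notMem_vars_op (hf i j).2 i
    rw [← TermClass.mk_eq_mk]
    exact absMany_eq_iff (X := termClassNom S V) (t i).vars_finite (s i).vars_finite
      (supports_mono (TermClass.supports_mk _) (t i).fv_subset_vars)
      (supports_mono (TermClass.supports_mk _) (s i).fv_subset_vars) (hz i)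
      (fun j => (h1 j).2) (fun j => (h2 j).2) (fun j => (h1 j).1) (fun j => (h2 j).1)
  constructor
  · intro h
    cases h with
    | op _ _ _ _ _ z hz hf h => exact fun i => (key z hz hf i).2 (h i)
  · intro h
    choose z hz hzA using fun i : Fin (S.numArgs f) => exists_fresh
      ((RawTerm.op f x t).vars_finite.union (RawTerm.op f y s).vars_finite) (S.numBind f i)
    have hf : ∀ i j, z i j ∉ (RawTerm.op f x t).vars ∧ z i j ∉ (RawTerm.op f y s).vars :=
      fun i j => ⟨fun h => hzA i j (Or.inl h), fun h => hzA i j (Or.inr h)⟩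
    exact AlphaEq.op f x y t s z hz hf fun i => (key z hz hf i).1 (h i)

/-- The structure map is obtained by factoring the term constructors through the surjection from `F
T_Σ` to `F_α (T_Σ/=_α)`. One direction of `alphaEq_op_iff` says that they respect its kernel. -/
theorem exists_termClass_str : ∃ k : (S.alphaFunctor V).obj (termClassNom S V) ⟶ termClassNom S V,
    (∀ x, Nom.fn k (alphaVar _ x) = TermClass.mk (RawTerm.var x)) ∧
      ∀ f x t, Nom.fn k (alphaOp f x fun i => TermClass.mk (t i)) =
        TermClass.mk (RawTerm.op f x t) := by
  obtain ⟨k, hk⟩ := Nom.exists_factor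
    ((S.quot V).app (rawTermNom S V) ≫ (S.alphaFunctor V).map (termClassMk S V))
    ((rawTermAlgebra S V).str ≫ termClassMk S V)
    (by
      intro c
      obtain ⟨d, rfl⟩ := alphaMap_surjective (termClassMk S V) TermClass.mk_surjective c
      obtain ⟨e, rfl⟩ := quot_surjective _ d
      exact ⟨e, rfl⟩)
    (by
      intro c d h
      rcases raw_cases c with ⟨x, rfl⟩ | ⟨f, x, t, rfl⟩ <;>
        rcases raw_cases d with ⟨y, rfl⟩ | ⟨g, y, s, rfl⟩
      · obtain rfl : x = y := Sum.inl_injective h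
        rfl
      · cases h
      · cases h
      · have hfg : f = g := congrArg Sigma.fst (Sum.inr_injective h)
        subst hfg
        refine TermClass.mk_eq_mk.2 (alphaEq_op_iff.2 ?_)
        exact (alphaMap_op (termClassMk S V) f x t).symm.trans
          (h.trans (alphaMap_op (termClassMk S V) f y s)))
  refine ⟨k, fun x => hk (rawVar _ x), fun f x t => ?_⟩
  refine Eq.trans ?_ (hk (rawOp (X := rawTermNom S V) f x t))
  exact congrArg (Nom.fn k) (alphaMap_op (termClassMk S V) f x t).symm

variable (S V) in
/-- The algebra of α-equivalence classes of finite raw terms. -/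
abbrev termClassAlgebra : Endofunctor.Algebra (S.alphaFunctor V) where
  a := termClassNom S V
  str := exists_termClass_str.choose

theorem termClassAlgebra_var (x : V) :
    Nom.fn (termClassAlgebra S V).str (alphaVar _ x) = TermClass.mk (RawTerm.var x) :=
  exists_termClass_str.choose_spec.1 x

theorem termClassAlgebra_op (f : S.Op) (x : ∀ i : Fin (S.numArgs f), Fin (S.numBind f i) → V)
    (t : Fin (S.numArgs f) → RawTerm S V) :
    Nom.fn (termClassAlgebra S V).str
      (alphaOp (X := termClassNom S V) f x fun i => TermClass.mk (t i)) =
      TermClass.mk (RawTerm.op f x t) :=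
  exists_termClass_str.choose_spec.2 f x t

theorem termClass_cases (c : (S.alphaFunctor V).obj (termClassNom S V)) :
    (∃ x, c = alphaVar _ x) ∨ ∃ f x, ∃ t : Fin (S.numArgs f) → RawTerm S V,
      c = alphaOp (X := termClassNom S V) f x fun i => TermClass.mk (t i) := by
  rcases alpha_cases c with h | ⟨f, x, a, rfl⟩
  · exact Or.inl h
  · choose t ht using fun i => TermClass.mk_surjective (a i)
    exact Or.inr ⟨f, x, t, by simp only [ht]⟩

/-- This is the other direction of `alphaEq_op_iff`. Applied to the signature with `*`, it lets
classes of truncated terms detect equality in the terminal sequence. -/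
theorem termClassAlgebra_str_injective :
    Function.Injective (Nom.fn (termClassAlgebra S V).str) := by
  intro c d h
  rcases termClass_cases c with ⟨x, rfl⟩ | ⟨f, x, t, rfl⟩ <;>
    rcases termClass_cases d with ⟨y, rfl⟩ | ⟨g, y, s, rfl⟩ <;>
    first
    | replace h := (termClassAlgebra_var _).symm.trans h
    | replace h := (termClassAlgebra_op _ _ _).symm.trans h
  all_goals first
    | replace h := TermClass.mk_eq_mk.1 (h.trans (termClassAlgebra_var _))
    | replace h := TermClass.mk_eq_mk.1 (h.trans (termClassAlgebra_op _ _ _))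
  · cases h
    rfl
  · cases h
  · cases h
  · have hfg : f = g := by
      cases h
      rfl
    subst hfg
    exact alphaEq_op_iff.1 h

/-- The `F`-algebra given by an `F_α`-algebra. -/
abbrev rawAlgebraOf (A : Endofunctor.Algebra (S.alphaFunctor V)) :
    Endofunctor.Algebra (S.rawFunctor V) :=
  (Endofunctor.Algebra.functorOfNatTrans (S.quot V)).obj A

/-- Evaluation is equivariant, so the names of a term support its value. The list `z` in the rule is
therefore fresh for the values too, and `absMany_eq_iff` applies to them. -/
theorem RawTerm.fold_alphaEq (A : Endofunctor.Algebra (S.alphaFunctor V)) {t s : RawTerm S V}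
    (h : AlphaEq t s) : t.fold (rawAlgebraOf A) = s.fold (rawAlgebraOf A) := by
  induction h with
  | var x => rfl
  | op f x y t s z hz hf _ ih =>
    refine congrArg (Nom.fn A.str) (alphaOp_eq_iff (X := A.a).2 fun i => ?_)
    have h1 := fun j => notMem_vars_op (hf i j).1 i
    have h2 := fun j => notMem_vars_op (hf i j).2 i
    have sup (r : RawTerm S V) :
        MulAction.Supports (FinPerm V) r.vars (r.fold (rawAlgebraOf A)) := fun π hπ => by
      rw [← RawTerm.fold_smul, r.supports_vars π hπ]
    refine (absMany_eq_iff (t i).vars_finite (s i).vars_finite (sup _) (sup _) (hz i)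
      (fun j => (h1 j).2) (fun j => (h2 j).2) (fun j => (h1 j).1) (fun j => (h2 j).1)).2 ?_
    have := ih i
    rwa [RawTerm.fold_smul, RawTerm.fold_smul] at this

theorem nonempty_isInitial_termClassAlgebra : Nonempty (IsInitial (termClassAlgebra S V)) := by
  refine ⟨IsInitial.ofUniqueHom (fun A => ⟨Nom.mkHom (X := termClassNom S V)
    (Quotient.lift (RawTerm.fold (rawAlgebraOf A)) fun _ _ h => RawTerm.fold_alphaEq A h) ?_, ?_⟩)
    fun A h => Endofunctor.Algebra.Hom.ext ?_⟩
  · rintro π ⟨t⟩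
    exact RawTerm.fold_smul _ π t
  · refine Nom.hom_ext fun c => ?_
    rcases termClass_cases c with ⟨x, rfl⟩ | ⟨f, x, t, rfl⟩
    · exact (congrArg (Quotient.lift (RawTerm.fold (rawAlgebraOf A)) fun _ _ h =>
        RawTerm.fold_alphaEq A h) (termClassAlgebra_var x)).symm
    · refine Eq.trans ?_ (congrArg (Quotient.lift (RawTerm.fold (rawAlgebraOf A)) fun _ _ h =>
        RawTerm.fold_alphaEq A h) (termClassAlgebra_op f x t)).symm
      exact congrArg (Nom.fn A.str) (alphaMap_op _ f x _)
  · refine Nom.hom_ext ?_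
    rintro ⟨t⟩
    have key (c) : Nom.fn A.str (Nom.fn ((S.alphaFunctor V).map h.f) c) =
      Nom.fn h.f (Nom.fn (termClassAlgebra S V).str c) := congrArg (fun k => Nom.fn k c) h.h
    change Nom.fn h.f (TermClass.mk t) = t.fold (rawAlgebraOf A)
    induction t with
    | var x =>
      exact (congrArg (Nom.fn h.f) (termClassAlgebra_var x)).symm.trans (key _).symm
    | op f x t ih =>
      refine ((congrArg (Nom.fn h.f) (termClassAlgebra_op f x t)).symm.trans (key _).symm).trans ?_
      refine congrArg (Nom.fn A.str) ((alphaMap_op h.f f x _).trans ?_)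
      exact congrArg (alphaOp f x) (funext ih)

end InitialAlgebras

/-! ### Truncated classes and the terminal sequence -/

section Truncation

variable {S : BindingSignature.{u}} {V : Type u}

variable (S) in
/-- The inclusion of the functors for the signatures without and with `*`. -/
def alphaWithStar (X : Nom V) :
    (S.alphaFunctor V).obj X ⟶ (S.withStar.alphaFunctor V).obj X :=
  Nom.mkHom (X := S.alphaObj V X) (Y := S.withStar.alphaObj V X)
    (Sum.elim (β := Σ f : S.Op, ∀ i : Fin (S.numArgs f), (absPow V (S.numBind f i)).obj X)
      Sum.inl (fun p => Sum.inr ⟨some p.1, p.2⟩)) (by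
    rintro π (x | ⟨f, p⟩) <;> rfl)

theorem alphaWithStar_injective (X : Nom V) : Function.Injective (Nom.fn (alphaWithStar S X)) := by
  rintro (x | ⟨f, c⟩) (y | ⟨g, d⟩) e
  · exact congrArg Sum.inl (Sum.inl_injective e)
  · cases e
  · cases e
  · have hfg : f = g := Option.some_injective _ (congrArg Sigma.fst (Sum.inr_injective e))
    subst hfg
    exact inr_sigma_congr f (inr_sigma_inj e)

/-- The projections of infinitary raw terms to the terminal sequence of `F_α`. -/
def InfTerm.projα (n : ℕ) (t : InfTerm S V) : iter (S.alphaFunctor V) n :=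
  Nom.fn (alphaIter S V n) (t.proj n)

theorem InfTerm.iterProj_projα (n : ℕ) (t : InfTerm S V) :
    Nom.fn (iterProj (S.alphaFunctor V) n) (t.projα (n + 1)) = t.projα n := by
  rw [InfTerm.projα, ← Nom.fn_comp, alphaIter_comp, Nom.fn_comp, InfTerm.iterProj_proj]
  rfl

variable [Infinite V]

variable (S V) in
/-- The class of raw terms, with `*` at depth `n`, of an element of the terminal sequence. -/
def iterToClass : (n : ℕ) → (iter (S.alphaFunctor V) n ⟶ termClassNom S.withStar V)
  | 0 => Nom.mkHom (X := Nom.one V) (Y := termClassNom S.withStar V)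
      (fun _ => TermClass.mk (star S V)) fun π _ => congrArg TermClass.mk (by
        refine Eq.trans ?_ (RawTerm.smul_op (S := S.withStar) π none _ _).symm
        exact congr (congrArg _ (funext fun i => i.elim0)) (funext fun i => i.elim0))
  | n + 1 => (S.alphaFunctor V).map (iterToClass n) ≫ alphaWithStar S _ ≫
      (termClassAlgebra S.withStar V).str

/-- By induction, since `F_α` preserves injections and the constructors are injective on classes. -/
theorem iterToClass_injective : ∀ n, Function.Injective (Nom.fn (iterToClass S V n))
  | 0 => fun _ _ _ => rfl
  | n + 1 => termClassAlgebra_str_injective.comp ((alphaWithStar_injective _).comp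
      (alphaMap_injective _ (iterToClass_injective n)))

theorem iterToClass_alphaIter (n : ℕ) (a : iter (S.rawFunctor V) n) :
    Nom.fn (iterToClass S V n) (Nom.fn (alphaIter S V n) a) = TermClass.mk (iterToRaw n a) := by
  induction n with
  | zero => rfl
  | succ n ih =>
    rcases raw_cases a with ⟨x, rfl⟩ | ⟨f, x, a, rfl⟩
    · exact termClassAlgebra_var x
    · refine Eq.trans ?_ (termClassAlgebra_op (S := S.withStar) (some f) x _)
      refine congrArg (Nom.fn (termClassAlgebra S.withStar V).str) ?_
      refine Eq.trans (congrArg (Nom.fn (alphaWithStar S _)) (alphaMap_op _ f x _)) ?_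
      exact congrArg (alphaOp (S := S.withStar) (some f) x) (funext fun i => ih (a i))

theorem InfTerm.iterToClass_projα (n : ℕ) (t : InfTerm S V) :
    Nom.fn (iterToClass S V n) (t.projα n) = TermClass.mk (t.trunc n) := by
  rw [InfTerm.projα, iterToClass_alphaIter, iterToRaw_proj]

/-- The bridge between the two versions: both sides become equality of classes of truncated terms
under the injection `iterToClass`. -/
theorem InfTerm.projα_eq_iff {n : ℕ} {t s : InfTerm S V} :
    t.projα n = s.projα n ↔ AlphaEq (t.trunc n) (s.trunc n) := by
  rw [← (iterToClass_injective n).eq_iff, InfTerm.iterToClass_projα, InfTerm.iterToClass_projα]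
  exact TermClass.mk_eq_mk

theorem RawTerm.projα_eq_iff {n : ℕ} {t s : RawTerm S V} : t.toInf.projα n = s.toInf.projα n ↔
    (TermClass.mk t).trunc n = (TermClass.mk s).trunc n := by
  rw [InfTerm.projα_eq_iff, RawTerm.trunc_toInf, RawTerm.trunc_toInf, TermClass.trunc_mk,
    TermClass.trunc_mk, TermClass.mk_eq_mk]

/-- The projections of α-equivalence classes to the terminal sequence of `F_α`. -/
def TermClass.proj (n : ℕ) : TermClass S V → iter (S.alphaFunctor V) n :=
  Quotient.lift (fun t => t.toInf.projα n) fun _ _ h =>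
    RawTerm.projα_eq_iff.2 (congrArg (TermClass.trunc n) (TermClass.mk_eq_mk.2 h))

theorem TermClass.proj_mk (n : ℕ) (t : RawTerm S V) :
    (TermClass.mk t).proj n = t.toInf.projα n := rfl

theorem TermClass.proj_eq_iff {n : ℕ} {a b : TermClass S V} :
    a.proj n = b.proj n ↔ a.trunc n = b.trunc n := by
  obtain ⟨t, rfl⟩ := TermClass.mk_surjective a
  obtain ⟨s, rfl⟩ := TermClass.mk_surjective b
  exact RawTerm.projα_eq_iff

theorem TermClass.iterToClass_proj (n : ℕ) (a : TermClass S V) :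
    Nom.fn (iterToClass S V n) (a.proj n) = a.trunc n := by
  obtain ⟨t, rfl⟩ := TermClass.mk_surjective a
  rw [TermClass.proj_mk, InfTerm.iterToClass_projα, RawTerm.trunc_toInf, TermClass.trunc_mk]

theorem TermClass.iterProj_proj (n : ℕ) (a : TermClass S V) :
    Nom.fn (iterProj (S.alphaFunctor V) n) (a.proj (n + 1)) = a.proj n := by
  obtain ⟨t, rfl⟩ := TermClass.mk_surjective a
  exact InfTerm.iterProj_projα n _

theorem TermClass.proj_smul (n : ℕ) (π : FinPerm V) (a : TermClass S V) :
    (π • a).proj n = π • a.proj n := by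
  refine iterToClass_injective n ?_
  rw [TermClass.iterToClass_proj, Nom.fn_smul, TermClass.iterToClass_proj]
  exact TermClass.trunc_smul π n a

end Truncation

/-! ### The completion and the limit of the terminal sequence -/

section CompletionLimit

variable {S : BindingSignature.{u}} {V : Type u}

theorem RawTerm.smul_mem_fv_smul (π : FinPerm V) (t : RawTerm S V)
    (v : V) : π • v ∈ (π • t).fv ↔ v ∈ t.fv := by
  induction t with
  | var x => exact (MulAction.injective π).eq_iff
  | op f x t ih =>
    rw [RawTerm.smul_op]
    simp only [RawTerm.fv, Set.mem_iUnion, Set.mem_sdiff, Set.mem_range, ih,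
      (MulAction.injective π).eq_iff]

/-- Every element of an `F_α`-coalgebra unfolds to an infinitary raw term. -/
theorem exists_projα_eq_cone (C : Endofunctor.Coalgebra (S.alphaFunctor V)) (c : C.V) :
    ∃ t : InfTerm S V, ∀ n, t.projα n = Nom.fn (cone C n) c := by
  -- A choice of binders for every element of the coalgebra. It need not be equivariant, so the
  -- unfolding is a mere function and its values may use infinitely many bound names.
  choose d hd using fun c : C.V => quot_surjective C.V (Nom.fn C.str c)
  obtain ⟨u, hv, ho⟩ := InfTerm.exists_unfold (S := S) (V := V) d
  refine ⟨u c, fun n => ?_⟩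
  induction n generalizing c with
  | zero => rfl
  | succ n ih =>
    refine Eq.trans ?_ (congrArg (Nom.fn ((S.alphaFunctor V).map (cone C n))) (hd c))
    rcases raw_cases (d c) with ⟨x, e⟩ | ⟨f, x, a, e⟩
    · rw [e, hv c x e]
      rfl
    · rw [e, ho c f _ e]
      refine Eq.trans ?_ (alphaMap_op (cone C n) f x a).symm
      exact congrArg (alphaOp f x) (funext fun i => ih (a i))

/-- The renaming fixes the free names that are not bound by `x` and sends those that are bound into
`z`, so binding `z` after renaming removes exactly the same names. -/
theorem RawTerm.mem_fv_transpList_smul {n : ℕ} {x z : Fin n → V} {t : RawTerm S V}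
    (hz : Function.Injective z) (hx : ∀ i j, z i ≠ x j) (ht : ∀ i, z i ∉ t.vars) (v : V) :
    v ∈ t.fv \ Set.range x ↔ v ∈ (transpList x z • t).fv \ Set.range z := by
  have fresh {w : V} (hw : w ∈ t.fv) (i : Fin n) : z i ≠ w :=
    fun e => ht i (e ▸ t.fv_subset_vars hw)
  constructor
  · rintro ⟨hv, hvx⟩
    rcases transpList_cases x z hz hx v (fresh hv) with ⟨j, hj, -⟩ | ⟨-, e⟩
    · exact absurd ⟨j, hj⟩ hvx
    · refine ⟨?_, fun ⟨j, hj⟩ => fresh hv j hj⟩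
      rw [← RawTerm.smul_mem_fv_smul (transpList x z), e] at hv
      exact hv
  · rintro ⟨hv, hvz⟩
    obtain ⟨w, rfl⟩ := MulAction.surjective (transpList x z) v
    rw [RawTerm.smul_mem_fv_smul] at hv
    rcases transpList_cases x z hz hx w (fresh hv) with ⟨j, -, e, -⟩ | ⟨hn, e⟩
    · exact absurd ⟨j, e.symm⟩ hvz
    · change transpList x z • w ∈ _
      rw [e]
      exact ⟨hv, fun ⟨j, hj⟩ => hn j hj⟩

theorem AlphaEq.fv_eq {t s : RawTerm S V} (h : AlphaEq t s) : t.fv = s.fv := by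
  induction h with
  | var x => rfl
  | op f x y t s z hz hf _ ih =>
    refine Set.iUnion_congr fun i => Set.ext fun v => ?_
    have h1 := fun j => notMem_vars_op (hf i j).1 i
    have h2 := fun j => notMem_vars_op (hf i j).2 i
    rw [RawTerm.mem_fv_transpList_smul (hz i) (fun j => (h1 j).1) (fun j => (h1 j).2), ih i,
      ← RawTerm.mem_fv_transpList_smul (hz i) (fun j => (h2 j).1) (fun j => (h2 j).2)]

variable [Infinite V]

theorem TermClass.trunc_eq_of_dist_lt {n : ℕ} {a b : TermClass S V}
    (h : dist a b < (1 / 2 : ℝ) ^ n) : a.trunc n = b.trunc n :=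
  rel_of_depthDist_lt (fun n a b => TermClass.trunc n a = TermClass.trunc n b)
    TermClass.trunc_zero TermClass.trunc_succ_eq h

theorem exists_dist_coe_lt (n : ℕ) (c : ClassCompletion S V) :
    ∃ a : TermClass S V, dist (a : ClassCompletion S V) c < (1 / 2 : ℝ) ^ (n + 1) := by
  obtain ⟨a, ha⟩ := (UniformSpace.Completion.denseRange_coe (α := TermClass S V)).exists_dist_lt c
    (by positivity : (0 : ℝ) < (1 / 2 : ℝ) ^ (n + 1))
  exact ⟨a, by rwa [dist_comm]⟩

/-- The projections of the completion to the terminal sequence of `F_α`. -/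
def classProj (n : ℕ) (c : ClassCompletion S V) : iter (S.alphaFunctor V) n :=
  (exists_dist_coe_lt n c).choose.proj n

/-- Two approximants at distance less than `2^{-(n+1)}` from `c` are at distance less than `2^{-n}`
from each other, hence agree at depth `n`. So the chosen approximant does not matter. -/
theorem classProj_eq {n : ℕ} {c : ClassCompletion S V} {a : TermClass S V}
    (h : dist (a : ClassCompletion S V) c < (1 / 2 : ℝ) ^ (n + 1)) : classProj n c = a.proj n := by
  refine TermClass.proj_eq_iff.2 (TermClass.trunc_eq_of_dist_lt ?_)
  rw [← UniformSpace.Completion.dist_eq]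
  have h' := (exists_dist_coe_lt n c).choose_spec
  have := dist_triangle_right ((exists_dist_coe_lt n c).choose : ClassCompletion S V) a c
  have e : (1 / 2 : ℝ) ^ (n + 1) + (1 / 2 : ℝ) ^ (n + 1) = (1 / 2 : ℝ) ^ n := by ring
  linarith

theorem eventually_classProj_eq {a : ℕ → TermClass S V} {c : ClassCompletion S V}
    (h : Tendsto (fun k => (a k : ClassCompletion S V)) atTop (𝓝 c)) (n : ℕ) :
    ∀ᶠ k in atTop, classProj n c = (a k).proj n :=
  (Metric.tendsto_nhds.1 h _ (by positivity : (0 : ℝ) < (1 / 2 : ℝ) ^ (n + 1))).mono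
    fun _ hk => classProj_eq hk

theorem exists_tendsto_coe (c : ClassCompletion S V) : ∃ a : ℕ → TermClass S V,
    Tendsto (fun k => (a k : ClassCompletion S V)) atTop (𝓝 c) := by
  choose a ha using fun n => exists_dist_coe_lt n c
  refine ⟨a, tendsto_iff_dist_tendsto_zero.2 (squeeze_zero (fun _ => dist_nonneg)
    (fun n => (ha n).le) ?_)⟩
  exact (tendsto_pow_atTop_nhds_zero_of_lt_one (by norm_num) (by norm_num)).comp
    (tendsto_add_atTop_nat 1)

theorem classProj_coe (n : ℕ) (a : TermClass S V) :
    classProj n (a : ClassCompletion S V) = a.proj n :=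
  classProj_eq (by rw [dist_self]; positivity)

theorem classProj_ext {c d : ClassCompletion S V} (h : ∀ n, classProj n c = classProj n d) :
    c = d := by
  refine eq_of_forall_dist_le fun ε hε => ?_
  -- The approximation errors sum to at most `2^{-n}` and the distance of the approximants is at
  -- most `2^{-n}`, so `2^{-n} < ε / 2` suffices.
  obtain ⟨n, hn⟩ := exists_pow_lt_of_lt_one (half_pos hε) (by norm_num : (1 / 2 : ℝ) < 1)
  obtain ⟨a, ha⟩ := exists_dist_coe_lt n c
  obtain ⟨b, hb⟩ := exists_dist_coe_lt n d
  have hab : dist (a : ClassCompletion S V) b ≤ (1 / 2 : ℝ) ^ n := by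
    rw [UniformSpace.Completion.dist_eq]
    refine TermClass.dist_le (TermClass.proj_eq_iff.1 ?_)
    rw [← classProj_eq ha, ← classProj_eq hb, h]
  have h1 := dist_triangle c a d
  have h2 := dist_triangle (a : ClassCompletion S V) b d
  rw [dist_comm c (a : ClassCompletion S V)] at h1
  have e : (1 / 2 : ℝ) ^ (n + 1) + (1 / 2 : ℝ) ^ (n + 1) = (1 / 2 : ℝ) ^ n := by ring
  linarith

theorem classProj_smul (n : ℕ) (π : FinPerm V) (c : ClassCompletion S V) :
    classProj n (π • c) = π • classProj n c := by
  obtain ⟨a, ha⟩ := exists_tendsto_coe c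
  have h' : Tendsto (fun k => ((π • a k : TermClass S V) : ClassCompletion S V)) atTop
      (𝓝 (π • c)) := by
    simp only [UniformSpace.Completion.coe_smul]
    exact ((continuous_const_smul π).tendsto c).comp ha
  obtain ⟨k, h1, h2⟩ :=
    ((eventually_classProj_eq ha n).and (eventually_classProj_eq h' n)).exists
  rw [h1, h2, TermClass.proj_smul]

theorem iterProj_classProj (n : ℕ) (c : ClassCompletion S V) :
    Nom.fn (iterProj (S.alphaFunctor V) n) (classProj (n + 1) c) = classProj n c := by
  obtain ⟨a, ha⟩ := exists_tendsto_coe c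
  obtain ⟨k, h1, h2⟩ :=
    ((eventually_classProj_eq ha n).and (eventually_classProj_eq ha (n + 1))).exists
  rw [h1, h2, TermClass.iterProj_proj]

theorem classProj_cls (n : ℕ) (t : InfTerm S V) : classProj n t.cls = t.projα n := by
  obtain ⟨k, h1, h2⟩ := ((eventually_classProj_eq t.tendsto_approx n).and
    (eventually_ge_atTop n)).exists
  rw [h1, TermClass.proj_mk, InfTerm.projα_eq_iff, RawTerm.trunc_toInf,
    InfTerm.trunc_approx_of_le h2]
  exact AlphaEq.refl _

theorem InfTerm.cls_eq_iff {t s : InfTerm S V} : t.cls = s.cls ↔ InfAlphaEq t s := by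
  refine ⟨fun h n => ?_, fun h => classProj_ext fun n => ?_⟩
  · rw [← InfTerm.projα_eq_iff, ← classProj_cls, ← classProj_cls, h]
  · rw [classProj_cls, classProj_cls, InfTerm.projα_eq_iff]
    exact h n

theorem RawTerm.cls_toInf (t : RawTerm S V) :
    t.toInf.cls = (TermClass.mk t : ClassCompletion S V) :=
  classProj_ext fun n => by rw [classProj_cls, classProj_coe, TermClass.proj_mk]

/-- The projections are equivariant and jointly injective. The same `A` serves at every level, as
lifting to the final coalgebra requires. -/
theorem supports_iff_classProj {A : Set V} {c : ClassCompletion S V} :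
    MulAction.Supports (FinPerm V) A c ↔
      ∀ n, MulAction.Supports (FinPerm V) A (classProj n c) := by
  refine ⟨fun h n π hπ => ?_, fun h π hπ => classProj_ext fun n => ?_⟩
  · rw [← classProj_smul, h π hπ]
  · rw [classProj_smul, h n π hπ]

/-! ### Free names and support -/

/-- The free names of a raw term are contained in each finite support of its class. -/
theorem RawTerm.fv_subset_of_supports {t : RawTerm S V} {A : Set V} (hA : A.Finite)
    (h : MulAction.Supports (FinPerm V) A (TermClass.mk t)) : t.fv ⊆ A := by
  intro x hx
  by_contra hxA
  -- If `x` were outside `A`, exchanging it with a fresh `z` would fix the class but turn the free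
  -- name `x` into `z`; α-equivalent terms have the same free names.
  obtain ⟨z, hz⟩ := (hA.union t.fv_finite).exists_notMem
  have e : AlphaEq (transp x z • t) t := TermClass.mk_eq_mk.1 (h (transp x z) fun v hv =>
    transp_other (fun e => hxA (e ▸ hv)) (fun e => hz (Or.inl (e ▸ hv))))
  rw [← RawTerm.smul_mem_fv_smul (transp x z), transp_left, e.fv_eq] at hx
  exact hz (Or.inr hx)

theorem InfTerm.supports_projα {t : InfTerm S V} (n : ℕ) :
    MulAction.Supports (FinPerm V) t.fv (t.projα n) := by
  intro π hπ
  refine iterToClass_injective n ?_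
  rw [Nom.fn_smul, InfTerm.iterToClass_projα]
  exact TermClass.supports_mk _ π fun v hv => hπ (Set.mem_iUnion.2 ⟨n, hv⟩)

/-- Together with `InfTerm.supports_projα` this shows that finiteness of the free names is the
existence of a common finite support of the projections. -/
theorem InfTerm.fv_subset_of_supports {t : InfTerm S V} {A : Set V} (hA : A.Finite)
    (h : ∀ n, MulAction.Supports (FinPerm V) A (t.projα n)) : t.fv ⊆ A := by
  refine Set.iUnion_subset fun n => RawTerm.fv_subset_of_supports hA ?_
  have := Nom.supports_fn (iterToClass S V n) (h n)
  rwa [InfTerm.iterToClass_projα] at this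

end CompletionLimit

/-! ### The two squares -/

section Squares

variable {S : BindingSignature.{u}} {V : Type u} [Infinite V]

theorem exists_cone_eq_projα {Tα : Endofunctor.Coalgebra (S.alphaFunctor V)} (hTα : IsTerminal Tα)
    (t : FfvTerm S V) : ∃ c : Tα.V, ∀ n, Nom.fn (cone Tα n) c = t.1.projα n :=
  (isSeqLimit_of_isTerminal (preservesSeqLimits_alphaFunctor S V) hTα).exists_lift
    (fun n => t.1.projα n) (fun n => t.1.iterProj_projα n) t.1.fv t.2
    fun n => InfTerm.supports_projα n

theorem InfTerm.fv_finite_of_projα_eq {C : Endofunctor.Coalgebra (S.alphaFunctor V)} {c : C.V} {t : InfTerm S V}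
    (h : ∀ n, t.projα n = Nom.fn (cone C n) c) : t.fv.Finite := by
  obtain ⟨A, hA, sA⟩ := exists_support c
  exact hA.subset (InfTerm.fv_subset_of_supports hA fun n => h n ▸ Nom.supports_fn _ sA)

/-- The first component of a point of `P` is an arbitrary infinitary term. A second component exists
iff the projections of the term have a common finite support, that is, iff its free names are
finitely many, and it is then unique because the cone of `Tα` is jointly injective. -/
theorem exists_pullback_equiv {Tα : Endofunctor.Coalgebra (S.alphaFunctor V)}
    (hTα : IsTerminal Tα) : ∃ e : PB S Tα ≃ FfvTerm S V, ∀ p n, (e p).1.proj n = p.1.1.1 n := by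
  have key (p : PB S Tα) : ∃ t : FfvTerm S V, ∀ n, t.1.proj n = p.1.1.1 n := by
    obtain ⟨t, ht⟩ := InfTerm.exists_proj_eq p.1.1
    refine ⟨⟨t, InfTerm.fv_finite_of_projα_eq (c := p.1.2) fun n => ?_⟩, ht⟩
    rw [InfTerm.projα, ht]
    exact congrFun (congrArg Subtype.val p.2) n
  choose e he using key
  refine ⟨Equiv.ofBijective e ⟨fun p q h => ?_, fun t => ?_⟩, he⟩
  · have h1 : p.1.1 = q.1.1 := Subtype.ext (funext fun n => by rw [← he, ← he, h])
    refine Subtype.ext (Prod.ext h1 ?_)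
    refine (isSeqLimit_of_isTerminal (preservesSeqLimits_alphaFunctor S V) hTα).ext _ _ fun n => ?_
    have hp := congrFun (congrArg Subtype.val p.2) n
    have hq := congrFun (congrArg Subtype.val q.2) n
    exact hp.symm.trans ((congrArg (fun a => (alphaLim S a).1 n) h1).trans hq)
  · obtain ⟨c, hc⟩ := exists_cone_eq_projα hTα t
    refine ⟨⟨(InfTerm.equivLim t.1, c), Subtype.ext (funext fun n => (hc n).symm)⟩,
      Subtype.ext (InfTerm.ext_proj fun n => he _ n)⟩

/-- Both sides embed into the limit of the sets `F_αⁿ1`. An element of `Tα` reaches the completion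
as the class of a raw term to which it unfolds; conversely, a finite support of a class supports all
its projections, so these lift to `Tα`. -/
theorem exists_final_equiv {Tα : Endofunctor.Coalgebra (S.alphaFunctor V)}
    (hTα : IsTerminal Tα) :
    ∃ e : Tα.V ≃ FsClass S V, ∀ c n, classProj n (e c).1 = Nom.fn (cone Tα n) c := by
  have key (c : Tα.V) : ∃ a : FsClass S V, ∀ n, classProj n a.1 = Nom.fn (cone Tα n) c := by
    obtain ⟨t, ht⟩ := exists_projα_eq_cone Tα c
    exact ⟨FfvTerm.cls ⟨t, InfTerm.fv_finite_of_projα_eq ht⟩, fun n => (classProj_cls n t).trans (ht n)⟩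
  choose e he using key
  refine ⟨Equiv.ofBijective e ⟨fun c d h => ?_, fun a => ?_⟩, he⟩
  · exact (isSeqLimit_of_isTerminal (preservesSeqLimits_alphaFunctor S V) hTα).ext _ _ fun n => by
      rw [← he, ← he, h]
  · obtain ⟨A, hA, sA⟩ := a.2
    obtain ⟨c, hc⟩ := (isSeqLimit_of_isTerminal (preservesSeqLimits_alphaFunctor S V)
      hTα).exists_lift (fun n => classProj n a.1) (fun n => iterProj_classProj n a.1) A hA
      (supports_iff_classProj.1 sA)
    exact ⟨c, Subtype.ext (classProj_ext fun n => (he c n).trans (hc n))⟩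

/-- A finitely supported class corresponds to an element of the final coalgebra, and unfolding that
element produces a raw representative with finitely many free names. -/
theorem FfvTerm.cls_surjective :
    Function.Surjective (FfvTerm.cls : FfvTerm S V → FsClass S V) := by
  intro a
  obtain ⟨C, hC⟩ := exists_coalgebra_isSeqLimit (preservesSeqLimits_alphaFunctor S V)
  obtain ⟨hC'⟩ := nonempty_isTerminal_of_isSeqLimit (preservesSeqLimits_alphaFunctor S V) hC
  obtain ⟨e, he⟩ := exists_final_equiv hC'
  obtain ⟨c, rfl⟩ := e.surjective a
  obtain ⟨t, ht⟩ := exists_projα_eq_cone C c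
  refine ⟨⟨t, InfTerm.fv_finite_of_projα_eq ht⟩, Subtype.ext (classProj_ext fun n => ?_)⟩
  exact (classProj_cls n t).trans ((ht n).trans (he c n).symm)

end Squares

/-! ### The maps out of the initial algebras. -/

section InitialSquares

variable {V : Type u}

/-- The coalgebra structure of `I` is the inverse of its algebra structure, so the two cancel. This
gives the recursion on levels by which the canonical map is computed on constructors. -/
theorem initialToFinal_cone_succ {G : Nom V ⥤ Nom V} {I : Endofunctor.Algebra G}
    (hI : IsInitial I) {T : Endofunctor.Coalgebra G} (hT : IsTerminal T) (n : ℕ) (c : G.obj I.a) :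
    Nom.fn (cone T (n + 1)) (Nom.fn (initialToFinal hI hT) (Nom.fn I.str c)) =
      Nom.fn (G.map (initialToFinal hI hT ≫ cone T n)) c := by
  have h : Endofunctor.Algebra.Initial.strInv hI ≫ G.map (initialToFinal hI hT) =
      initialToFinal hI hT ≫ T.str :=
    (hT.from ⟨I.a, Endofunctor.Algebra.Initial.strInv hI⟩).h
  have e : I.str ≫ initialToFinal hI hT ≫ cone T (n + 1) =
      G.map (initialToFinal hI hT ≫ cone T n) := by
    change I.str ≫ initialToFinal hI hT ≫ T.str ≫ G.map (cone T n) = _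
    rw [← Category.assoc (initialToFinal hI hT), ← h, Category.assoc, ← Category.assoc,
      Endofunctor.Algebra.Initial.right_inv hI, Category.id_comp, Functor.map_comp]
  exact congrArg (fun k => Nom.fn k c) e

theorem exists_initial_str_eq {G : Nom V ⥤ Nom V} {I : Endofunctor.Algebra G}
    (hI : IsInitial I) (a : I.a) : ∃ c, Nom.fn I.str c = a :=
  ⟨Nom.fn (Endofunctor.Algebra.Initial.strInv hI) a,
    congrArg (fun k => Nom.fn k a) (Endofunctor.Algebra.Initial.left_inv hI)⟩

/-- The bijection underlying an isomorphism of algebras. -/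
def algebraIsoEquiv {G : Nom V ⥤ Nom V} {A B : Endofunctor.Algebra G} (e : A ≅ B) : A.a ≃ B.a where
  toFun := Nom.fn e.hom.f
  invFun := Nom.fn e.inv.f
  left_inv a := congrArg (fun k => Nom.fn (Endofunctor.Algebra.Hom.f k) a) e.hom_inv_id
  right_inv b := congrArg (fun k => Nom.fn (Endofunctor.Algebra.Hom.f k) b) e.inv_hom_id

theorem algebra_hom_str {G : Nom V ⥤ Nom V} {A B : Endofunctor.Algebra G} (h : A ⟶ B)
    (c : G.obj A.a) : Nom.fn h.f (Nom.fn A.str c) = Nom.fn B.str (Nom.fn (G.map h.f) c) :=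
  (congrArg (fun k => Nom.fn k c) h.h).symm

variable {S : BindingSignature.{u}}

theorem cone_initialToFinal_raw {I : Endofunctor.Algebra (S.rawFunctor V)} (hI : IsInitial I)
    {T : Endofunctor.Coalgebra (S.rawFunctor V)} (hT : IsTerminal T) (e : I ⟶ rawTermAlgebra S V)
    (n : ℕ) (a : I.a) : Nom.fn (cone T n) (Nom.fn (initialToFinal hI hT) a) =
      (show RawTerm S V from Nom.fn e.f a).toInf.proj n := by
  induction n generalizing a with
  | zero => rfl
  | succ n ih =>
    obtain ⟨c, rfl⟩ := exists_initial_str_eq hI a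
    rw [initialToFinal_cone_succ, algebra_hom_str]
    rcases raw_cases c with ⟨x, rfl⟩ | ⟨f, x, a, rfl⟩
    · rfl
    · exact inr_sigma_congr f (funext fun i => congrArg (Prod.mk (x i)) (ih (a i)))

variable [Infinite V]

theorem cone_initialToFinal_alpha {I : Endofunctor.Algebra (S.alphaFunctor V)} (hI : IsInitial I)
    {T : Endofunctor.Coalgebra (S.alphaFunctor V)} (hT : IsTerminal T)
    (e : I ⟶ termClassAlgebra S V) (n : ℕ) (a : I.a) :
    Nom.fn (cone T n) (Nom.fn (initialToFinal hI hT) a) = TermClass.proj n (Nom.fn e.f a) := by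
  induction n generalizing a with
  | zero => rfl
  | succ n ih =>
    obtain ⟨c, rfl⟩ := exists_initial_str_eq hI a
    rw [initialToFinal_cone_succ, algebra_hom_str]
    rcases alpha_cases c with ⟨x, rfl⟩ | ⟨f, x, a, rfl⟩
    · exact (congrArg (TermClass.proj (n + 1)) (termClassAlgebra_var (S := S) x)).symm
    · choose t ht using fun i => TermClass.mk_surjective (Nom.fn e.f (a i))
      refine (alphaMap_op _ f x a).trans ?_
      refine Eq.trans ?_ (congrArg (TermClass.proj (n + 1)) ((congrArg
        (Nom.fn (termClassAlgebra S V).str) ((alphaMap_op e.f f x a).trans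
          (congrArg (alphaOp f x) (funext fun i => (ht i).symm)))).trans
            (termClassAlgebra_op f x t))).symm
      exact congrArg (alphaOp f x) (funext fun i => (ih (a i)).trans
        (congrArg (TermClass.proj n) (ht i).symm))

/-- The projection of raw terms to their classes is a morphism of algebras. -/
def termClassMkHom : rawTermAlgebra S V ⟶ rawAlgebraOf (termClassAlgebra S V) where
  f := termClassMk S V
  h := Nom.hom_ext fun c => by
    rcases raw_cases c with ⟨x, rfl⟩ | ⟨f, x, t, rfl⟩
    · exact termClassAlgebra_var x
    · exact termClassAlgebra_op f x t

/-- Both sides are `F`-algebra morphisms from `I` to the algebra of classes, so initiality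
identifies them. -/
theorem alphaInitial_comp {I : Endofunctor.Algebra (S.rawFunctor V)} (hI : IsInitial I)
    {Iα : Endofunctor.Algebra (S.alphaFunctor V)} (e : I ⟶ rawTermAlgebra S V)
    (eα : Iα ⟶ termClassAlgebra S V) (a : I.a) :
    Nom.fn eα.f (Nom.fn (alphaInitial S hI Iα) a) = TermClass.mk (Nom.fn e.f a) := by
  have h : hI.to (rawAlgebraOf Iα) ≫ (Endofunctor.Algebra.functorOfNatTrans (S.quot V)).map eα =
      e ≫ termClassMkHom := hI.hom_ext _ _
  exact congrArg (fun k => Nom.fn (Endofunctor.Algebra.Hom.f k) a) h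

end InitialSquares

end

/-! ### Assembly of the theorem. -/

theorem mainTheorem2 {V : Type u} [Countable V] [Infinite V] (S : BindingSignature.{u}) :
    -- `(T_Σ^∞)_ffv` completes `T_Σ` by the Cauchy sequences with finitely many free names in total
    ((∀ t : InfTerm S V, t.fv.Finite ↔
        ∃ s : ℕ → RawTerm S V, (⋃ k, (s k).fv).Finite ∧
          Tendsto (fun k => (s k).toInf) atTop (𝓝 t)) ∧
      (∀ s : ℕ → RawTerm S V, (⋃ k, (s k).fv).Finite → CauchySeq (fun k => (s k).toInf) →
        ∃! t : InfTerm S V, t.fv.Finite ∧ Tendsto (fun k => (s k).toInf) atTop (𝓝 t))) ∧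
    -- syntactic version: the square commutes, the vertical maps quotient by `=_α` and are onto
    ((∀ t : RawTerm S V, t.toFfv.cls = (TermClass.mk t).toFs) ∧
      (∀ t s : FfvTerm S V, t.cls = s.cls ↔ InfAlphaEq t.1 s.1) ∧
      Function.Surjective (FfvTerm.cls : FfvTerm S V → FsClass S V)) ∧
    -- the initial algebras and final coalgebras of the semantic version exist
    (HasInitial (Endofunctor.Algebra (S.rawFunctor V)) ∧
      HasInitial (Endofunctor.Algebra (S.alphaFunctor V)) ∧
      HasTerminal (Endofunctor.Coalgebra (S.rawFunctor V)) ∧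
      HasTerminal (Endofunctor.Coalgebra (S.alphaFunctor V))) ∧
    ∀ (I : Endofunctor.Algebra (S.rawFunctor V)) (hI : IsInitial I)
      (Iα : Endofunctor.Algebra (S.alphaFunctor V)) (hIα : IsInitial Iα)
      (T : Endofunctor.Coalgebra (S.rawFunctor V)) (hT : IsTerminal T)
      (Tα : Endofunctor.Coalgebra (S.alphaFunctor V)) (hTα : IsTerminal Tα),
      -- semantic version: the square commutes and the vertical maps are onto
      ((∀ a : I.a, alphaPB S Tα (initialToPB S hI hT hTα a) =
          Nom.fn (initialToFinal hIα hTα) (Nom.fn (alphaInitial S hI Iα) a)) ∧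
        Function.Surjective (Nom.fn (alphaInitial S hI Iα)) ∧
        Function.Surjective (alphaPB S Tα)) ∧
      -- the two squares are isomorphic
      ∃ (eI : I.a ≃ RawTerm S V) (eIα : Iα.a ≃ TermClass S V)
        (eP : PB S Tα ≃ FfvTerm S V) (eTα : Tα.V ≃ FsClass S V),
        (∀ (π : FinPerm V) (a : I.a), eI (π • a) = π • eI a) ∧
        (∀ (π : FinPerm V) (a : Iα.a), eIα (π • a) = π • eIα a) ∧
        (∀ (π : FinPerm V) (a : Tα.V), (eTα (π • a)).1 = π • (eTα a).1) ∧
        (∀ a : I.a, eP (initialToPB S hI hT hTα a) = (eI a).toFfv) ∧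
        (∀ a : I.a, eIα (Nom.fn (alphaInitial S hI Iα) a) = TermClass.mk (eI a)) ∧
        (∀ a : Iα.a, eTα (Nom.fn (initialToFinal hIα hTα) a) = (eIα a).toFs) ∧
        (∀ p : PB S Tα, eTα (alphaPB S Tα p) = (eP p).cls) := by
  refine ⟨⟨InfTerm.fv_finite_iff, fun s => InfTerm.existsUnique_limit⟩,
    ⟨fun t => Subtype.ext t.cls_toInf, fun t s => Subtype.ext_iff.trans InfTerm.cls_eq_iff,
      FfvTerm.cls_surjective⟩,
    ⟨nonempty_isInitial_rawTermAlgebra.some.hasInitial,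
      nonempty_isInitial_termClassAlgebra.some.hasInitial,
      hasTerminal_coalgebra (preservesSeqLimits_rawFunctor S V),
      hasTerminal_coalgebra (preservesSeqLimits_alphaFunctor S V)⟩,
    fun I hI Iα hIα T hT Tα hTα => ?_⟩
  let i := hI.uniqueUpToIso (nonempty_isInitial_rawTermAlgebra (S := S) (V := V)).some
  let iα := hIα.uniqueUpToIso (nonempty_isInitial_termClassAlgebra (S := S) (V := V)).some
  let eI : I.a ≃ RawTerm S V := algebraIsoEquiv i
  let eIα : Iα.a ≃ TermClass S V := algebraIsoEquiv iα
  obtain ⟨eP, hP⟩ := exists_pullback_equiv hTα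
  obtain ⟨eT, hT'⟩ := exists_final_equiv hTα
  have hraw (n : ℕ) (a : I.a) :
      Nom.fn (cone T n) (Nom.fn (initialToFinal hI hT) a) = (eI a).toInf.proj n :=
    cone_initialToFinal_raw hI hT i.hom n a
  have halpha (n : ℕ) (a : Iα.a) :
      Nom.fn (cone Tα n) (Nom.fn (initialToFinal hIα hTα) a) = (eIα a).proj n :=
    cone_initialToFinal_alpha hIα hTα iα.hom n a
  have hmk (a : I.a) : eIα (Nom.fn (alphaInitial S hI Iα) a) = TermClass.mk (eI a) :=
    alphaInitial_comp hI i.hom iα.hom a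
  have hPT (p : PB S Tα) : eT (alphaPB S Tα p) = (eP p).cls :=
    -- At level `n` both sides are the image in `F_αⁿ1` of the first component of `p`, by the
    -- defining equation of the pullback.
    Subtype.ext (classProj_ext fun n => by
      refine (hT' _ n).trans (Eq.trans ?_ (classProj_cls n (eP p).1).symm)
      rw [InfTerm.projα, hP]
      exact (congrFun (congrArg Subtype.val p.2) n).symm)
  refine ⟨⟨fun a => ?_, fun b => ?_, fun b => ?_⟩, eI, eIα, eP, eT, fun π a => ?_, fun π a => ?_,
    fun π a => ?_, fun a => ?_, hmk, fun a => ?_, hPT⟩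
  · refine (isSeqLimit_of_isTerminal (preservesSeqLimits_alphaFunctor S V) hTα).ext _ _ fun n => ?_
    rw [halpha, hmk, TermClass.proj_mk, InfTerm.projα, ← hraw, ← Nom.fn_comp (cone T n),
      alphaFinal_cone S T hTα]
    rfl
  -- Both surjectivity statements are transported from the syntactic square along the bijections.
  · obtain ⟨t, ht⟩ := TermClass.mk_surjective (eIα b)
    exact ⟨eI.symm t, eIα.injective (by rw [hmk, Equiv.apply_symm_apply, ht])⟩
  · obtain ⟨t, ht⟩ := FfvTerm.cls_surjective (eT b)
    exact ⟨eP.symm t, eT.injective (by rw [hPT, Equiv.apply_symm_apply, ht])⟩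
  · exact Nom.fn_smul i.hom.f π a
  · exact Nom.fn_smul iα.hom.f π a
  · exact classProj_ext fun n => by rw [classProj_smul, hT', hT', Nom.fn_smul]
  · exact Subtype.ext (InfTerm.ext_proj fun n => (hP _ n).trans (hraw n a))
  · refine Subtype.ext (classProj_ext fun n => (hT' _ n).trans ((halpha n a).trans ?_))
    exact (classProj_coe n (eIα a)).symm
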